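/- Let $\mathcal X$ be a finite alphabet, let $\{X_n\}_{n\in\mathbb Z}$ be a two-sided stationary and ergodic time series with values in $\mathcal X$, and let $g:\mathcal X\to\mathbb R$ be arbitrary. Write $X_m^n=(X_m,\dots,X_n)$ and $X_{-\infty}^0=(\dots,X_{-1},X_0)$. For $k\ge 1$ and $n\ge 0$ put $\tau^k_0(n)=0$ and, for $i\ge1$, $$\tau^k_i(n)=\min\{t>\tau^k_{i-1}(n): X_{n-k+1-t}^{n-t}=X_{n-k+1}^{n}\}$$ (with $\min\emptyset=\infty$). Let $$K_n=\max\bigl(1,\lfloor 0.1\log_{|\mathcal X|}n\rfloor\bigr),\qquad J_n=\max\bigl(1,\lceil n^{0.5}\rceil\bigr)\qquad(n\ge1)$$ (with $K_n=1$ if $|\mathcal X|=1$). Let $$\kappa_n=\max\{1\le k\le K_n:\ \tau^k_{J_n}(n)\le n-k+1\}$$ if there is such a $k$, and $\kappa_n=0$ otherwise; let $$\lambda_n=\max\{j\ge1:\ \tau^{\kappa_n}_j(n)\le n-\kappa_n+1\}$$ if $\kappa_n>0$, and $\lambda_n=0$ otherwise. Define the estimator by $g_0=0$ and, for $n\ge1$,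 $$g_n=\frac1{\lambda_n}\sum_{i=1}^{\lambda_n} g\bigl(X_{n-\tau^{\kappa_n}_i(n)+1}\bigr)$$ if $\kappa_n>0$, and $g_n=0$ otherwise. On the set $\mathcal X^{*-}$ of all one-sided sequences $(\dots,x_{-1},x_0)$ in $\mathcal X$ consider the metric $$d^*(x_{-\infty}^0,y_{-\infty}^0)=\sum_{i=0}^\infty 2^{-i-1}\mathbf 1_{\{x_{-i}\ne y_{-i}\}}.$$ Then: (A) If there is a function $G:\mathcal X^{*-}\to\mathbb R$, continuous on $\mathcal X^{*-}$ with respect to $d^*$, such that $G(X_{-\infty}^0)=E(g(X_1)\mid X_{-\infty}^0)$ almost surely, then $$\lim_{n\to\infty}\bigl|g_n-E(g(X_{n+1})\mid X_0^n)\bigr|=0\quad\text{almost surely.}$$ (B) Without any continuity assumption, $$\lim_{n\to\infty}\frac1n\sum_{i=0}^{n-1}\bigl|g_i-E(g(X_{i+1})\mid X_0^i)\bigr|=0\quad\text{almost surely.}$$ (C) Without any continuity assumption, for every $\epsilon>0$, $$\lim_{n\to\infty}P\bigl(\bigl|g_n-E(g(X_{n+1})\mid X_0^n)\bigr|>\epsilon\bigr)=0.$$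 -/

import Mathlib

open MeasureTheory Filter Topology

noncomputable section

namespace Forecast

/-- The left shift `(T x)_i = x_{i+1}` on two-sided sequences. -/
def shift {α : Type*} (x : ℤ → α) : ℤ → α := fun i => x (i + 1)

/-- The random two-sided sequence `(X_i(ω))_{i ∈ ℤ}`. -/
def path {Ω α : Type*} (X : ℤ → Ω → α) (ω : Ω) : ℤ → α := fun i => X i ω

/-- `X` is a stationary and ergodic two-sided time series: every `X i` is a random variable, and
the law of the whole sequence is invariant (`Ergodic` includes measure preservation) and ergodic
under the left shift. -/
def IsStationaryErgodic {Ω α : Type*} [MeasurableSpace Ω] [MeasurableSpace α]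
    (μ : Measure Ω) (X : ℤ → Ω → α) : Prop :=
  (∀ i, Measurable (X i)) ∧ Ergodic (shift (α := α)) (μ.map (path X))

/-- The σ-algebra generated by the variables `X i`, `i ∈ s`. -/
abbrev sigmaOf {Ω α : Type*} [MeasurableSpace α] (X : ℤ → Ω → α) (s : Set ℤ) : MeasurableSpace Ω :=
  MeasurableSpace.comap (fun ω (i : s) => X i ω) MeasurableSpace.pi

/-- `τ^k_i(n)`: `τ^k_0(n) = 0` and
`τ^k_{i+1}(n) = min {t > τ^k_i(n) : x_{n-k+1-t}^{n-t} = x_{n-k+1}^n}`, which is `⊤` if there is no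
such `t`. -/
def tau {α : Type*} (x : ℤ → α) (k n : ℕ) : ℕ → ℕ∞
  | 0 => 0
  | i + 1 => sInf ((fun t : ℕ => (t : ℕ∞)) '' {t : ℕ | tau x k n i < (t : ℕ∞) ∧
      ∀ j : ℤ, (n : ℤ) - k + 1 ≤ j → j ≤ n → x (j - t) = x j})

/-- `K_n = max(1, ⌊0.1 log_{|α|} n⌋)`. -/
def K (α : Type*) [Fintype α] (n : ℕ) : ℕ :=
  max 1 ⌊(0.1 : ℝ) * Real.logb (Fintype.card α) n⌋₊

/-- `J_n = max(1, ⌈n^{0.5}⌉)`. -/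
def J (n : ℕ) : ℕ := max 1 ⌈(n : ℝ) ^ (0.5 : ℝ)⌉₊

/-- `κ_n = max {1 ≤ k ≤ K_n : τ^k_{J_n}(n) ≤ n - k + 1}`, and `0` if there is no such `k`. -/
def kappa {α : Type*} [Fintype α] (x : ℤ → α) (n : ℕ) : ℕ :=
  sSup {k : ℕ | 1 ≤ k ∧ k ≤ K α n ∧ tau x k n (J n) + k ≤ n + 1}

open Classical in
/-- `λ_n = max {j ≥ 1 : τ^{κ_n}_j(n) ≤ n - κ_n + 1}` if `κ_n > 0`, and `0` otherwise. -/
def lam {α : Type*} [Fintype α] (x : ℤ → α) (n : ℕ) : ℕ :=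
  if 0 < kappa x n then
    sSup {j : ℕ | 1 ≤ j ∧ tau x (kappa x n) n j + kappa x n ≤ n + 1}
  else 0

open Classical in
/-- The estimator `g_n`, as a function of the realization `x`. -/
def estimator {α : Type*} [Fintype α] (g : α → ℝ) (x : ℤ → α) (n : ℕ) : ℝ :=
  if 1 ≤ n ∧ 0 < kappa x n then
    (1 / (lam x n : ℝ)) *
      ∑ i ∈ Finset.Icc 1 (lam x n), g (x ((n : ℤ) - (tau x (kappa x n) n i).toNat + 1))
  else 0

open Classical in
/-- The metric `d*` on one-sided pasts; the coordinate `x i` of `x : ℕ → α` stands for `x_{-i}`. -/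
def dStar {α : Type*} (x y : ℕ → α) : ℝ :=
  ∑' i : ℕ, (2 : ℝ)⁻¹ ^ (i + 1) * (if x i ≠ y i then 1 else 0)

/-- Some version `G` of `E(g(X_1) | X_{-∞}^0)`, a function on all one-sided pasts, is continuous
with respect to `d*`. -/
def HasContinuousVersion {Ω α : Type*} [MeasurableSpace Ω] [MeasurableSpace α]
    (μ : Measure Ω) (X : ℤ → Ω → α) (g : α → ℝ) : Prop :=
  ∃ G : (ℕ → α) → ℝ,
    (fun ω => G fun i => X (-(i : ℤ)) ω) =ᵐ[μ] μ[fun ω => g (X 1 ω) | sigmaOf X (Set.Iic 0)] ∧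
    ∀ x, ∀ ε > 0, ∃ δ > 0, ∀ y, dStar x y < δ → |G y - G x| < ε

/-- The error `|g_n - E(g(X_{n+1}) | X_0^n)|`. -/
def error {Ω α : Type*} [MeasurableSpace Ω] [MeasurableSpace α] [Fintype α]
    (μ : Measure Ω) (X : ℤ → Ω → α) (g : α → ℝ) (n : ℕ) (ω : Ω) : ℝ :=
  |estimator g (path X ω) n -
    (μ[fun ω' => g (X ((n : ℤ) + 1) ω') | sigmaOf X (Set.Icc 0 (n : ℤ))]) ω|

end Forecast

end

/-!
By stationarity `E(g(X_{n+1}) | X_0^n)` is `E(g(X_1) | X_{-n}^0)` evaluated at the sequence shifted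
to time `n`, while the estimator is the average of `g(X_{s+1})` over the earlier occurrences `s` of
the last `κ_n` letters. For a fixed word, occurring at time `s` is an event of the past of `s`, so
replacing `g(X_{s+1})` by its mean given the past of `s` costs a martingale with bounded
increments; its exponential tail `e^{-δ J_n}` beats the roughly `n^{0.1}` words of length at most
`K_n`, because `J_n ≥ √n`. By Borel-Cantelli it remains to compare conditional means at the
occurrences with the one at time `n`.

With a continuous version, pasts that agree on many letters have uniformly close conditional means,
and ergodicity gives `κ_n ≥ min(k, K_n)` eventually, for every `k`. In general,
`E(g(X_1) | X_{-k}^0)` is the same at all occurrences of a word of more than `k` letters. Its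
distance `D_k` to the mean given the whole past satisfies `∫ D_k → 0`, and a maximal inequality
over the occurrences of each word shows that the average of `D_k` over the occurrences is large
only for few times `n`.
-/

noncomputable section

namespace Forecast

open scoped Finset

section Visits

variable {β : Type*}

open Classical in
/-- The times of the window `[b, n)` at which the sequence `c` takes the value `c n`. -/
def visits (c : ℕ → β) (b n : ℕ) : Finset ℕ := {s ∈ Finset.Ico b n | c s = c n}

lemma mem_visits {c : ℕ → β} {b n s : ℕ} : s ∈ visits c b n ↔ (b ≤ s ∧ s < n) ∧ c s = c n := by
  simp [visits]

lemma sum_visits_add (c : ℕ → β) (b n a : ℕ) (f : ℕ → ℝ) :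
    ∑ s ∈ visits (fun s => c (s + a)) b n, f (s + a) = ∑ s ∈ visits c (b + a) (n + a), f s := by
  classical
  have h : visits c (b + a) (n + a) =
      (visits (fun s => c (s + a)) b n).map (addRightEmbedding a) := by
    rw [visits, visits, ← Finset.map_add_right_Ico, Finset.filter_map]
    rfl
  rw [h, Finset.sum_map]
  rfl

lemma card_visits_add (c : ℕ → β) (b n a : ℕ) :
    #(visits (fun s => c (s + a)) b n) = #(visits c (b + a) (n + a)) := by
  simpa using sum_visits_add c b n a fun _ => 1

open Classical in
lemma card_filter_not_disjoint_visits_le (c : ℕ → β) (b : ℕ → ℕ) {B : Finset ℕ} {m : ℕ}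
    (hm : ∀ m' ∈ B, m' ≤ m) :
    #{m' ∈ B | ¬ Disjoint (visits c (b m') m') (visits c (b m) m)} ≤ #(visits c (b m) m) := by
  rcases (visits c (b m) m).eq_empty_or_nonempty with hempty | hne
  · simp [hempty]
  have hsub : {m' ∈ B | ¬ Disjoint (visits c (b m') m') (visits c (b m) m)} ⊆
      insert m ((visits c (b m) m).erase ((visits c (b m) m).min' hne)) := by
    intro m' hm'
    obtain ⟨hm'B, hmeet⟩ := Finset.mem_filter.1 hm'
    obtain ⟨s, hs', hs⟩ := Finset.not_disjoint_iff.1 hmeet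
    have hmin := Finset.min'_le _ _ hs
    rw [mem_visits] at hs hs'
    rw [Finset.mem_insert, Finset.mem_erase, mem_visits]
    rcases (hm m' hm'B).eq_or_lt with h | h
    · exact Or.inl h
    · exact Or.inr ⟨by omega, ⟨by omega, h⟩, hs'.2.symm.trans hs.2⟩
  refine (Finset.card_le_card hsub).trans ((Finset.card_insert_le _ _).trans_eq ?_)
  exact Finset.card_erase_add_one (Finset.min'_mem _ _)

/-- A maximal inequality along the classes `{s | c s = w}`, proved greedily: by
`card_filter_not_disjoint_visits_le`, the window of the last `m ∈ B` pays for all `m' ∈ B` whose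
windows share a visit with it. -/
lemma mul_card_le_sum_biUnion_visits (c : ℕ → β) {a : ℕ → ℝ} (ha : ∀ s, 0 ≤ a s) {ε : ℝ}
    (hε : 0 ≤ ε) (b : ℕ → ℕ) (B : Finset ℕ)
    (hB : ∀ m ∈ B, ε * #(visits c (b m) m) < ∑ s ∈ visits c (b m) m, a s) :
    ε * #B ≤ ∑ s ∈ B.biUnion fun m => visits c (b m) m, a s := by
  classical
  induction B using Finset.strongInduction with
  | H B ih =>
    rcases B.eq_empty_or_nonempty with rfl | hne
    · simp
    set I : ℕ → Finset ℕ := fun m => visits c (b m) m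
    set m := B.max' hne
    have hmB : m ∈ B := B.max'_mem hne
    set R : Finset ℕ := {m' ∈ B | ¬ Disjoint (I m') (I m)} with hR
    have hIm : (I m).Nonempty := Finset.nonempty_of_sum_ne_zero (f := a) fun h => by
      have := hB m hmB
      rw [h] at this
      exact absurd this (not_lt.2 (by positivity))
    have hRB : R ⊆ B := Finset.filter_subset _ _
    have hRne : R.Nonempty :=
      ⟨m, Finset.mem_filter.2 ⟨hmB, fun h => hIm.ne_empty (disjoint_self.1 h)⟩⟩
    have hdisj : Disjoint ((B \ R).biUnion I) (I m) := by
      refine (Finset.disjoint_biUnion_left _ _ _).2 fun m' hm' => ?_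
      simpa [hR, (Finset.mem_sdiff.1 hm').1] using (Finset.mem_sdiff.1 hm').2
    calc ε * #B = ε * #(B \ R) + ε * #R := by
          rw [← Finset.card_sdiff_add_card_eq_card hRB]; push_cast; ring
      _ ≤ ε * #(B \ R) + ε * #(I m) := by
          refine add_le_add_right (mul_le_mul_of_nonneg_left ?_ hε) _
          exact_mod_cast card_filter_not_disjoint_visits_le c b (m := m) B.le_max'
      _ ≤ ∑ s ∈ (B \ R).biUnion I, a s + ∑ s ∈ I m, a s :=
          add_le_add (ih _ (Finset.sdiff_ssubset hRB hRne) fun m' hm' =>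
            hB m' (Finset.mem_sdiff.1 hm').1) (hB m hmB).le
      _ = ∑ s ∈ (B \ R).biUnion I ∪ I m, a s := (Finset.sum_union hdisj).symm
      _ ≤ ∑ s ∈ B.biUnion I, a s :=
          Finset.sum_le_sum_of_subset_of_nonneg (Finset.union_subset
            (Finset.biUnion_subset_biUnion_of_subset_left _ Finset.sdiff_subset)
            (Finset.subset_biUnion_of_mem I hmB)) fun s _ _ => ha s

lemma mul_card_le_sum_range (c : ℕ → β) {a : ℕ → ℝ} (ha : ∀ s, 0 ≤ a s) {ε : ℝ} (hε : 0 ≤ ε)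
    (b : ℕ → ℕ) {N : ℕ} {B : Finset ℕ} (hBN : ∀ m ∈ B, m ≤ N)
    (hB : ∀ m ∈ B, ε * #(visits c (b m) m) < ∑ s ∈ visits c (b m) m, a s) :
    ε * #B ≤ ∑ s ∈ Finset.range N, a s := by
  refine (mul_card_le_sum_biUnion_visits c ha hε b B hB).trans
    (Finset.sum_le_sum_of_subset_of_nonneg ?_ fun s _ _ => ha s)
  refine Finset.biUnion_subset.2 fun m hm s hs => Finset.mem_range.2 ?_
  exact (mem_visits.1 hs).1.2.trans_le (hBN m hm)

lemma card_le_of_few_visits [Fintype β] (c : ℕ → β) {b j : ℕ} {B : Finset ℕ}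
    (hb : ∀ m ∈ B, b ≤ m) (hB : ∀ m ∈ B, #(visits c b m) < j) :
    #B ≤ Fintype.card β * j := by
  classical
  have hclass : ∀ w, #{m ∈ B | c m = w} ≤ j := by
    intro w
    rcases Finset.eq_empty_or_nonempty {m ∈ B | c m = w} with hempty | hne
    · simp [hempty]
    set m := Finset.max' _ hne
    have hm : m ∈ B ∧ c m = w := by simpa using Finset.max'_mem _ hne
    have hsub : {m ∈ B | c m = w} ⊆ insert m (visits c b m) := by
      intro s hs
      have hsm := Finset.le_max' _ s hs
      obtain ⟨hsB, hsw⟩ := Finset.mem_filter.1 hs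
      rw [Finset.mem_insert, mem_visits]
      rcases hsm.eq_or_lt with h | h
      · exact Or.inl h
      · exact Or.inr ⟨⟨hb s hsB, h⟩, hsw.trans hm.2.symm⟩
    exact (Finset.card_le_card hsub).trans ((Finset.card_insert_le _ _).trans (hB m hm.1))
  rw [mul_comm]
  exact Finset.card_le_mul_card_image_of_maps_to (f := c) (fun _ _ => Finset.mem_univ _) j
    fun w _ => hclass w

lemma card_le_of_few_visits_of_le_add [Fintype β] (c : ℕ → β) {b l j : ℕ} {B : Finset ℕ}
    (hb : ∀ m ∈ B, b ≤ m + l) (hB : ∀ m ∈ B, #(visits c b m) < j) :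
    #B ≤ Fintype.card β * j + l := by
  have hlate : #{m ∈ B | b ≤ m} ≤ Fintype.card β * j :=
    card_le_of_few_visits c (fun m hm => (Finset.mem_filter.1 hm).2) fun m hm =>
      hB m (Finset.mem_filter.1 hm).1
  have hearly : #{m ∈ B | ¬ b ≤ m} ≤ l := by
    have hsub : {m ∈ B | ¬ b ≤ m} ⊆ Finset.Ico (b - l) b := fun m hm => by
      have := hb m (Finset.mem_filter.1 hm).1
      have := (Finset.mem_filter.1 hm).2
      rw [Finset.mem_Ico]
      omega
    exact (Finset.card_le_card hsub).trans (by rw [Nat.card_Ico]; omega)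
  rw [← Finset.card_filter_add_card_filter_not (s := B) (b ≤ ·)]
  exact Nat.add_le_add hlate hearly

end Visits

section RecurrenceTimes

variable {α : Type*}

/-- The word of length `k` ending at time `n`, read backwards. -/
def word (x : ℤ → α) (k : ℕ) (n : ℤ) : Fin k → α := fun j => x (n - (j : ℕ))

open Classical in
/-- The backward distances `1 ≤ t ≤ L` at which the last `k` letters at time `n` reoccur. -/
def recurrences (x : ℤ → α) (k n L : ℕ) : Finset ℕ :=
  {t ∈ Finset.Icc 1 L | word x k ((n : ℤ) - t) = word x k n}

/-- The times `s < n` at which the last `k` letters at time `n` occur inside `x_0, …, x_s`. -/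
def matchTimes (x : ℤ → α) (k n : ℕ) : Finset ℕ := visits (fun s : ℕ => word x k s) (k - 1) n

lemma mem_recurrences {x : ℤ → α} {k n L t : ℕ} :
    t ∈ recurrences x k n L ↔ (1 ≤ t ∧ t ≤ L) ∧ word x k ((n : ℤ) - t) = word x k n := by
  simp [recurrences]

lemma mem_matchTimes {x : ℤ → α} {k n s : ℕ} :
    s ∈ matchTimes x k n ↔ (k ≤ s + 1 ∧ s < n) ∧ word x k s = word x k n := by
  rw [matchTimes, mem_visits, tsub_le_iff_right]

lemma word_sub_eq_iff (x : ℤ → α) (k n t : ℕ) :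
    word x k ((n : ℤ) - t) = word x k n ↔
      ∀ j : ℤ, (n : ℤ) - k + 1 ≤ j → j ≤ n → x (j - t) = x j := by
  refine ⟨fun h j hkj hjn => ?_, fun h => funext fun j => ?_⟩
  · have := congrFun h ⟨((n : ℤ) - j).toNat, by omega⟩
    simp only [word, Int.toNat_of_nonneg (sub_nonneg.2 hjn)] at this
    convert this using 2 <;> ring
  · rw [word, word, ← h ((n : ℤ) - (j : ℕ)) (by omega) (by omega), sub_right_comm]

lemma word_eq_of_le {x : ℤ → α} {k l : ℕ} {a b : ℤ} (h : word x l a = word x l b) (hkl : k ≤ l) :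
    word x k a = word x k b :=
  funext fun j => congrFun h (j.castLE hkl)

lemma tau_succ_le_iff (x : ℤ → α) (k n i L : ℕ) :
    tau x k n (i + 1) ≤ L ↔
      ∃ t : ℕ, t ≤ L ∧ tau x k n i < t ∧ word x k ((n : ℤ) - t) = word x k n := by
  have hL : (L : ℕ∞) ≠ ⊤ := ENat.natCast_ne_top L
  rw [← ENat.lt_add_one_iff hL, tau, sInf_lt_iff, Set.exists_mem_image]
  simp only [ENat.lt_add_one_iff hL, word_sub_eq_iff, Nat.cast_le, Set.mem_ofPred_eq,
    and_comm (a := _ ≤ L)]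

lemma tau_succ_le_add_one_iff (x : ℤ → α) (k n i L : ℕ) :
    tau x k n (i + 1) ≤ (L + 1 : ℕ) ↔ tau x k n (i + 1) ≤ L ∨
      tau x k n i ≤ L ∧ word x k ((n : ℤ) - (L + 1 : ℕ)) = word x k n := by
  have hL : tau x k n i < (L + 1 : ℕ) ↔ tau x k n i ≤ L := by
    rw [Nat.cast_add_one, ENat.lt_add_one_iff (ENat.natCast_ne_top L)]
  simp only [tau_succ_le_iff, Nat.le_add_one_iff, or_and_right, exists_or, exists_eq_left, hL]

open Classical in
lemma recurrences_succ (x : ℤ → α) (k n L : ℕ) :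
    recurrences x k n (L + 1) =
      if word x k ((n : ℤ) - (L + 1 : ℕ)) = word x k n then insert (L + 1) (recurrences x k n L)
      else recurrences x k n L := by
  rw [recurrences, ← Finset.insert_Icc_right_eq_Icc_add_one (by omega), Finset.filter_insert]
  rfl

lemma notMem_recurrences (x : ℤ → α) (k n L : ℕ) : L + 1 ∉ recurrences x k n L :=
  fun h => absurd (mem_recurrences.1 h).1.2 (by omega)

lemma tau_le_iff (x : ℤ → α) (k n i L : ℕ) : tau x k n i ≤ L ↔ i ≤ #(recurrences x k n L) := by
  induction L generalizing i with
  | zero =>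
    cases i with
    | zero => simp [tau]
    | succ i =>
      rw [tau_succ_le_iff]
      simp [recurrences]
  | succ L ih =>
    cases i with
    | zero => simp [tau]
    | succ i =>
      rw [tau_succ_le_add_one_iff, ih, ih, recurrences_succ]
      split_ifs with h
      · rw [Finset.card_insert_of_notMem (notMem_recurrences x k n L)]
        simp only [h, and_true]
        omega
      · simp only [h, and_false, or_false]

lemma sum_tau (x : ℤ → α) (k n L : ℕ) (f : ℕ → ℝ) :
    ∑ i ∈ Finset.Icc 1 #(recurrences x k n L), f (tau x k n i).toNat =
      ∑ t ∈ recurrences x k n L, f t := by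
  induction L with
  | zero => simp [recurrences]
  | succ L ih =>
    by_cases h : word x k ((n : ℤ) - (L + 1 : ℕ)) = word x k n
    · have hcard : #(recurrences x k n (L + 1)) = #(recurrences x k n L) + 1 := by
        rw [recurrences_succ, if_pos h, Finset.card_insert_of_notMem (notMem_recurrences x k n L)]
      have htau : tau x k n (#(recurrences x k n L) + 1) = (L + 1 : ℕ) := by
        refine le_antisymm ((tau_le_iff ..).2 hcard.ge) ?_
        have : ¬ tau x k n (#(recurrences x k n L) + 1) ≤ L := by simp [tau_le_iff]
        exact_mod_cast Order.add_one_le_of_lt (not_le.1 this)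
      rw [hcard, Finset.sum_Icc_succ_top (by omega), ih, htau, recurrences_succ, if_pos h,
        Finset.sum_insert (notMem_recurrences x k n L), ENat.toNat_natCast, add_comm]
    · simpa only [recurrences_succ, if_neg h] using ih

lemma sum_recurrences (x : ℤ → α) {k : ℕ} (hk : 1 ≤ k) (n : ℕ) (f : ℕ → ℝ) :
    ∑ t ∈ recurrences x k n (n + 1 - k), f (n - t) = ∑ s ∈ matchTimes x k n, f s := by
  refine Finset.sum_bij' (fun t _ => n - t) (fun s _ => n - s) (fun t ht => ?_) (fun s hs => ?_)
    (fun t ht => ?_) (fun s hs => ?_) fun _ _ => rfl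
  · rw [mem_recurrences] at ht
    rw [mem_matchTimes, Nat.cast_sub (by omega)]
    exact ⟨by omega, ht.2⟩
  · rw [mem_matchTimes] at hs
    rw [mem_recurrences, Nat.cast_sub hs.1.2.le, sub_sub_cancel]
    exact ⟨by omega, hs.2⟩
  · have := mem_recurrences.1 ht
    omega
  · have := mem_matchTimes.1 hs
    omega

lemma card_recurrences (x : ℤ → α) {k : ℕ} (hk : 1 ≤ k) (n : ℕ) :
    #(recurrences x k n (n + 1 - k)) = #(matchTimes x k n) := by
  simpa using sum_recurrences x hk n fun _ => 1

lemma tau_add_le_iff (x : ℤ → α) {k j : ℕ} (hk : 1 ≤ k) (hj : 1 ≤ j) (n : ℕ) :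
    tau x k n j + k ≤ n + 1 ↔ j ≤ #(matchTimes x k n) := by
  have hpos : ¬ tau x k n j ≤ (0 : ℕ) := by
    rw [tau_le_iff]
    simpa [recurrences] using Nat.ne_of_gt hj
  rw [← card_recurrences x hk, ← tau_le_iff]
  generalize tau x k n j = t at hpos ⊢
  cases t with
  | top => simp
  | coe t =>
    norm_cast at hpos ⊢
    omega

end RecurrenceTimes

section Estimator

variable {α : Type*} [Fintype α]

lemma one_le_J (n : ℕ) : 1 ≤ J n := le_max_left _ _

lemma one_le_K (α : Type*) [Fintype α] (n : ℕ) : 1 ≤ K α n := le_max_left _ _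

lemma kappa_eq (x : ℤ → α) (n : ℕ) :
    kappa x n = sSup {k : ℕ | 1 ≤ k ∧ k ≤ K α n ∧ J n ≤ #(matchTimes x k n)} := by
  have h (k : ℕ) (hk : 1 ≤ k) := tau_add_le_iff x hk (one_le_J n) n
  grind [kappa]

lemma bddAbove_kappa (x : ℤ → α) (n : ℕ) :
    BddAbove {k : ℕ | 1 ≤ k ∧ k ≤ K α n ∧ J n ≤ #(matchTimes x k n)} :=
  ⟨K α n, fun _ hk => hk.2.1⟩

lemma le_kappa {x : ℤ → α} {n k : ℕ} (hk : 1 ≤ k) (hkK : k ≤ K α n)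
    (hJ : J n ≤ #(matchTimes x k n)) : k ≤ kappa x n := by
  rw [kappa_eq]
  exact le_csSup (bddAbove_kappa x n) ⟨hk, hkK, hJ⟩

lemma kappa_mem {x : ℤ → α} {n : ℕ} (h : 0 < kappa x n) :
    kappa x n ≤ K α n ∧ J n ≤ #(matchTimes x (kappa x n) n) := by
  have hne : {k : ℕ | 1 ≤ k ∧ k ≤ K α n ∧ J n ≤ #(matchTimes x k n)}.Nonempty := by
    refine Set.nonempty_iff_ne_empty.2 fun hempty => h.ne' ?_
    rw [kappa_eq, hempty, csSup_empty, Nat.bot_eq_zero]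
  have := Nat.sSup_mem hne (bddAbove_kappa x n)
  rw [← kappa_eq] at this
  exact this.2

lemma kappa_eq_K {x : ℤ → α} {n : ℕ} (h : J n ≤ #(matchTimes x (K α n) n)) :
    kappa x n = K α n := by
  have hle := le_kappa (one_le_K α n) le_rfl h
  exact le_antisymm (kappa_mem ((one_le_K α n).trans hle)).1 hle

lemma lam_eq {x : ℤ → α} {n : ℕ} (h : 0 < kappa x n) :
    lam x n = #(matchTimes x (kappa x n) n) := by
  have hset : {j : ℕ | 1 ≤ j ∧ tau x (kappa x n) n j + kappa x n ≤ n + 1} =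
      Set.Icc 1 #(matchTimes x (kappa x n) n) :=
    Set.ext fun j => and_congr_right fun hj => tau_add_le_iff x h hj n
  rw [lam, if_pos h, hset, csSup_Icc ((one_le_J n).trans (kappa_mem h).2)]

lemma estimator_eq (g : α → ℝ) {x : ℤ → α} {n : ℕ} (h : 0 < kappa x n) :
    estimator g x n = (1 / (#(matchTimes x (kappa x n) n) : ℝ)) *
      ∑ s ∈ matchTimes x (kappa x n) n, g (x ((s : ℤ) + 1)) := by
  have hn : 1 ≤ n := by
    obtain ⟨s, hs⟩ := Finset.card_pos.1 ((one_le_J n).trans (kappa_mem h).2)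
    exact Nat.one_le_of_lt (mem_matchTimes.1 hs).1.2
  rw [estimator, if_pos ⟨hn, h⟩, lam_eq h, ← sum_recurrences x h n, ← card_recurrences x h,
    sum_tau x (kappa x n) n (n + 1 - kappa x n) fun t => g (x ((n : ℤ) - t + 1))]
  refine congrArg _ (Finset.sum_congr rfl fun t ht => ?_)
  have := mem_recurrences.1 ht
  rw [Nat.cast_sub (by omega)]

lemma abs_estimator_le {g : α → ℝ} {C : ℝ} (hg : ∀ a, |g a| ≤ C) (x : ℤ → α) (n : ℕ) :
    |estimator g x n| ≤ C := by
  by_cases h : 0 < kappa x n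
  · have hcard : (0 : ℝ) < #(matchTimes x (kappa x n) n) := by
      exact_mod_cast (one_le_J n).trans (kappa_mem h).2
    rw [estimator_eq g h, abs_mul, abs_of_pos (by positivity), one_div, inv_mul_le_iff₀ hcard]
    refine (Finset.abs_sum_le_sum_abs _ _).trans ((Finset.sum_le_sum fun s _ => hg _).trans ?_)
    simp
  · rw [estimator, if_neg fun hn => h hn.2, abs_zero]
    exact (abs_nonneg _).trans (hg (x 0))

end Estimator

section Growth

lemma J_mono : Monotone J := fun _ _ hmn =>
  max_le_max le_rfl (Nat.ceil_le_ceil (Real.rpow_le_rpow (by positivity) (by exact_mod_cast hmn)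
    (by norm_num)))

lemma rpow_half_le_J (n : ℕ) : (n : ℝ) ^ (0.5 : ℝ) ≤ J n :=
  (Nat.le_ceil _).trans (by exact_mod_cast le_max_right _ _)

lemma J_le {n : ℕ} (hn : 1 ≤ n) : (J n : ℝ) ≤ 2 * (n : ℝ) ^ (0.5 : ℝ) := by
  have hone : (1 : ℝ) ≤ (n : ℝ) ^ (0.5 : ℝ) := Real.one_le_rpow (by exact_mod_cast hn) (by norm_num)
  have hceil := Nat.ceil_lt_add_one (zero_le_one.trans hone)
  rw [J, Nat.cast_max, Nat.cast_one]
  exact max_le (by linarith) (by linarith)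

lemma tendsto_J_div : Tendsto (fun n : ℕ => (J n : ℝ) / n) atTop (𝓝 0) := by
  have hlim := ((tendsto_rpow_neg_atTop (by norm_num : (0 : ℝ) < 0.5)).comp
    tendsto_natCast_atTop_atTop).const_mul 2
  rw [mul_zero] at hlim
  refine squeeze_zero' (.of_forall fun n => by positivity) ?_ hlim
  filter_upwards [eventually_ge_atTop 1] with n hn
  have hn0 : (0 : ℝ) < n := by exact_mod_cast hn
  rw [div_le_iff₀ hn0, Function.comp_apply, mul_assoc, ← Real.rpow_add_one hn0.ne']
  exact (J_le hn).trans_eq (by norm_num)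

variable (α : Type*) [Fintype α]

lemma exists_K_eq : ∃ c : ℝ, 0 ≤ c ∧ ∀ n, K α n = max 1 ⌊c * Real.log n⌋₊ :=
  ⟨0.1 / Real.log (Fintype.card α), div_nonneg (by norm_num) (Real.log_natCast_nonneg _),
    fun n => by rw [K, Real.logb, ← mul_div_assoc, div_mul_eq_mul_div]⟩

lemma K_mono : Monotone (K α) := by
  obtain ⟨c, hc, hK⟩ := exists_K_eq α
  intro m n hmn
  rw [hK, hK]
  refine max_le_max le_rfl (Nat.floor_le_floor (mul_le_mul_of_nonneg_left ?_ hc))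
  rcases m.eq_zero_or_pos with rfl | hm
  · simpa using Real.log_natCast_nonneg n
  · exact Real.log_le_log (by exact_mod_cast hm) (by exact_mod_cast hmn)

lemma exists_K_le_add {η : ℝ} (hη : 0 < η) :
    ∃ L : ℕ, ∀ N m : ℕ, η * N ≤ m → K α N ≤ K α m + L := by
  obtain ⟨c, hc, hK⟩ := exists_K_eq α
  refine ⟨⌈c * Real.log η⁻¹⌉₊, fun N m hNm => ?_⟩
  rcases N.eq_zero_or_pos with rfl | hN
  · exact (K_mono α m.zero_le).trans (Nat.le_add_right _ _)
  have hN' : (0 : ℝ) < N := by exact_mod_cast hN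
  have hlog : Real.log N ≤ Real.log m + Real.log η⁻¹ := by
    have hm : (0 : ℝ) < m := (mul_pos hη hN').trans_le hNm
    rw [← Real.log_mul hm.ne' (inv_pos.2 hη).ne', ← div_eq_mul_inv]
    exact Real.log_le_log hN' ((le_div_iff₀' hη).2 hNm)
  have hfloor : ⌊c * Real.log N⌋₊ ≤ ⌊c * Real.log m⌋₊ + ⌈c * Real.log η⁻¹⌉₊ := by
    rw [← Nat.floor_add_natCast (mul_nonneg hc (Real.log_natCast_nonneg m))]
    refine Nat.floor_le_floor ((mul_le_mul_of_nonneg_left hlog hc).trans ?_)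
    rw [mul_add]
    gcongr
    exact Nat.le_ceil _
  rw [hK, hK]
  omega

lemma K_le_card_pow_K [Nonempty α] (n : ℕ) : K α n ≤ Fintype.card α ^ K α n := by
  rcases Nat.eq_or_lt_of_le (Fintype.card_pos (α := α)) with hcard | hcard
  · have hK : K α n = 1 := by simp [K, ← hcard]
    rw [hK, ← hcard, pow_one]
  · exact (Nat.lt_pow_self hcard).le

lemma card_pow_K_le [Nonempty α] {n : ℕ} (hn : 1 ≤ n) :
    (Fintype.card α : ℝ) ^ K α n ≤ Fintype.card α * (n : ℝ) ^ (0.1 : ℝ) := by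
  have hn' : (1 : ℝ) ≤ n := by exact_mod_cast hn
  have hr : (1 : ℝ) ≤ (n : ℝ) ^ (0.1 : ℝ) := Real.one_le_rpow hn' (by norm_num)
  rcases Nat.eq_or_lt_of_le (Fintype.card_pos (α := α)) with hcard | hcard
  · simpa [← hcard] using hr
  have hcard' : (1 : ℝ) < Fintype.card α := by exact_mod_cast hcard
  have hfloor : (Fintype.card α : ℝ) ^ ⌊(0.1 : ℝ) * Real.logb (Fintype.card α) n⌋₊ ≤
      (n : ℝ) ^ (0.1 : ℝ) := by
    rw [← Real.rpow_natCast]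
    refine (Real.rpow_le_rpow_of_exponent_le hcard'.le (Nat.floor_le
      (mul_nonneg (by norm_num) (Real.logb_nonneg hcard' hn')))).trans_eq ?_
    rw [mul_comm, Real.rpow_mul (by positivity), Real.rpow_logb (by positivity) hcard'.ne'
      (by positivity)]
  rcases max_cases 1 ⌊(0.1 : ℝ) * Real.logb (Fintype.card α) n⌋₊ with ⟨h, -⟩ | ⟨h, -⟩
  · rw [K, h, pow_one]
    exact le_mul_of_one_le_right (by positivity) hr
  · rw [K, h]
    exact hfloor.trans (le_mul_of_one_le_left (by positivity) hcard'.le)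

lemma add_one_mul_card_pow_K_le [Nonempty α] {n : ℕ} (hn : 1 ≤ n) :
    ((K α n + 1) * Fintype.card α ^ K α n : ℝ) ≤
      2 * (Fintype.card α : ℝ) ^ 2 * (n : ℝ) ^ (0.2 : ℝ) := by
  have hpow := card_pow_K_le α hn
  have hone : (1 : ℝ) ≤ K α n := by exact_mod_cast one_le_K α n
  have hK : (K α n : ℝ) ≤ Fintype.card α ^ K α n := by exact_mod_cast K_le_card_pow_K α n
  calc ((K α n + 1) * Fintype.card α ^ K α n : ℝ)
      ≤ 2 * (Fintype.card α * (n : ℝ) ^ (0.1 : ℝ)) * (Fintype.card α * (n : ℝ) ^ (0.1 : ℝ)) := by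
        gcongr
        linarith
    _ = 2 * (Fintype.card α : ℝ) ^ 2 * ((n : ℝ) ^ (0.1 : ℝ) * (n : ℝ) ^ (0.1 : ℝ)) := by ring
    _ = 2 * (Fintype.card α : ℝ) ^ 2 * (n : ℝ) ^ (0.2 : ℝ) := by
        rw [← Real.rpow_add (by exact_mod_cast hn)]
        norm_num

lemma tendsto_words_mul_J_div [Nonempty α] :
    Tendsto (fun n : ℕ =>
      (((K α n + 1) * (Fintype.card α ^ K α n * J n + K α n) : ℕ) : ℝ) / n) atTop (𝓝 0) := by
  have hlim := ((tendsto_rpow_neg_atTop (by norm_num : (0 : ℝ) < 0.3)).comp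
    tendsto_natCast_atTop_atTop).const_mul (8 * (Fintype.card α : ℝ) ^ 2)
  rw [mul_zero] at hlim
  refine squeeze_zero' (.of_forall fun n => by positivity) ?_ hlim
  filter_upwards [eventually_ge_atTop 1] with n hn
  have hn0 : (0 : ℝ) < n := by exact_mod_cast hn
  have hK : Fintype.card α ^ K α n * J n + K α n ≤ 2 * (Fintype.card α ^ K α n * J n) := by
    rw [two_mul]
    gcongr
    exact (K_le_card_pow_K α n).trans (Nat.le_mul_of_pos_right _ (one_le_J n))
  rw [div_le_iff₀ hn0, Function.comp_apply, mul_assoc, ← Real.rpow_add_one hn0.ne']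
  calc (((K α n + 1) * (Fintype.card α ^ K α n * J n + K α n) : ℕ) : ℝ)
      ≤ (((K α n + 1) * (2 * (Fintype.card α ^ K α n * J n)) : ℕ) : ℝ) := by gcongr
    _ = ((K α n + 1) * Fintype.card α ^ K α n) * (2 * J n) := by push_cast; ring
    _ ≤ 2 * (Fintype.card α : ℝ) ^ 2 * (n : ℝ) ^ (0.2 : ℝ) * (2 * (2 * (n : ℝ) ^ (0.5 : ℝ))) :=
        mul_le_mul (add_one_mul_card_pow_K_le α hn) (by linarith [J_le hn]) (by positivity)
          (by positivity)
    _ = 8 * (Fintype.card α : ℝ) ^ 2 * ((n : ℝ) ^ (0.2 : ℝ) * (n : ℝ) ^ (0.5 : ℝ)) := by ring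
    _ = 8 * (Fintype.card α : ℝ) ^ 2 * (n : ℝ) ^ (-0.3 + 1 : ℝ) := by
        rw [← Real.rpow_add hn0]
        norm_num

lemma summable_words_mul_exp [Nonempty α] {δ : ℝ} (hδ : 0 < δ) :
    Summable fun n : ℕ =>
      ((K α n + 1) * Fintype.card α ^ K α n : ℝ) * Real.exp (-δ * J n) := by
  have hexp : (fun n : ℕ => Real.exp (-δ * (n : ℝ) ^ (0.5 : ℝ))) =O[atTop]
      fun n : ℕ => (n : ℝ) ^ (-2 : ℝ) := by
    refine ((isLittleO_exp_neg_mul_rpow_atTop hδ (-4)).isBigO.comp_tendsto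
      ((tendsto_rpow_atTop (by norm_num : (0 : ℝ) < 0.5)).comp
        tendsto_natCast_atTop_atTop)).congr_right fun n => ?_
    rw [Function.comp_apply, Function.comp_apply, ← Real.rpow_mul n.cast_nonneg]
    norm_num
  have hsummable : Summable fun n : ℕ => (n : ℝ) ^ (0.2 : ℝ) * (n : ℝ) ^ (-2 : ℝ) := by
    refine (Real.summable_nat_rpow.2 (by norm_num : (-1.8 : ℝ) < -1)).congr_atTop ?_
    filter_upwards [eventually_ge_atTop 1] with n hn
    rw [← Real.rpow_add (by exact_mod_cast hn)]
    norm_num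
  refine summable_of_isBigO_nat hsummable (.mul ?_ ?_)
  · refine .of_bound (2 * (Fintype.card α : ℝ) ^ 2) ?_
    filter_upwards [eventually_ge_atTop 1] with n hn
    rw [Real.norm_of_nonneg (by positivity), Real.norm_of_nonneg (by positivity)]
    exact add_one_mul_card_pow_K_le α hn
  · refine .trans (.of_bound' (.of_forall fun n => ?_)) hexp
    rw [Real.norm_of_nonneg (by positivity), Real.norm_of_nonneg (by positivity), Real.exp_le_exp]
    exact mul_le_mul_of_nonpos_left (rpow_half_le_J n) (neg_nonpos.2 hδ.le)

lemma subsingleton_or_tendsto_K : Subsingleton α ∨ Tendsto (K α) atTop atTop := by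
  rcases le_or_gt (Fintype.card α) 1 with hcard | hcard
  · exact Or.inl (Fintype.card_le_one_iff_subsingleton.1 hcard)
  · refine Or.inr (tendsto_atTop_mono (fun n => le_max_right _ _) ?_)
    refine tendsto_nat_floor_atTop.comp (Tendsto.const_mul_atTop (by norm_num) ?_)
    exact (Real.tendsto_logb_atTop (by exact_mod_cast hcard)).comp tendsto_natCast_atTop_atTop

lemma eventually_word_eq_of_min_le (k : ℕ) : ∀ᶠ n in atTop, ∀ (x : ℤ → α) (a b : ℤ) (l : ℕ),
    min k (K α n) ≤ l → word x l a = word x l b → word x k a = word x k b := by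
  rcases subsingleton_or_tendsto_K α with h | h
  · exact .of_forall fun n x a b l _ _ => Subsingleton.elim _ _
  · filter_upwards [h.eventually_ge_atTop k] with n hn x a b l hl hw
    exact word_eq_of_le hw (by omega)

end Growth

section Ergodic

variable {X : Type*} {T : X → X} {f : X → ℝ}

/-- The maximum of the Birkhoff sums of length at most `n`, the empty one included, written as a
recursion along the orbit because this is the form in which its increments are compared. -/
def maxBirkhoffSum (T : X → X) (f : X → ℝ) : ℕ → X → ℝ
  | 0 => 0
  | n + 1 => fun x => max 0 (f x + maxBirkhoffSum T f n (T x))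

lemma maxBirkhoffSum_nonneg (n : ℕ) (x : X) : 0 ≤ maxBirkhoffSum T f n x := by
  cases n with
  | zero => exact le_rfl
  | succ n => exact le_max_left _ _

lemma maxBirkhoffSum_le_succ (n : ℕ) (x : X) :
    maxBirkhoffSum T f n x ≤ maxBirkhoffSum T f (n + 1) x := by
  induction n generalizing x with
  | zero => exact maxBirkhoffSum_nonneg 1 x
  | succ n ih => exact max_le_max le_rfl (by linarith [ih (T x)])

lemma monotone_maxBirkhoffSum (x : X) : Monotone fun n => maxBirkhoffSum T f n x :=
  monotone_nat_of_le_succ fun n => maxBirkhoffSum_le_succ n x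

lemma birkhoffSum_le_maxBirkhoffSum (n : ℕ) (x : X) :
    birkhoffSum T f n x ≤ maxBirkhoffSum T f n x := by
  induction n generalizing x with
  | zero => exact le_of_eq (birkhoffSum_zero T f x)
  | succ n ih =>
    rw [birkhoffSum_succ']
    exact le_max_of_le_right (by linarith [ih (T x)])

lemma maxBirkhoffSum_sub_le_indicator (n : ℕ) (x : X) :
    maxBirkhoffSum T f n x - maxBirkhoffSum T f n (T x) ≤
      {x | 0 < maxBirkhoffSum T f n x}.indicator f x := by
  by_cases hx : 0 < maxBirkhoffSum T f n x
  · rw [Set.indicator_of_mem (by exact hx)]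
    cases n with
    | zero => exact absurd hx (lt_irrefl _)
    | succ n =>
      have hrec : maxBirkhoffSum T f (n + 1) x = f x + maxBirkhoffSum T f n (T x) :=
        (max_choice 0 (f x + maxBirkhoffSum T f n (T x))).resolve_left hx.ne'
      linarith [maxBirkhoffSum_le_succ (T := T) (f := f) n (T x)]
  · rw [Set.indicator_of_notMem (by exact hx)]
    linarith [maxBirkhoffSum_nonneg (T := T) (f := f) n (T x)]

lemma bddAbove_birkhoffSum_comp_iff (x : X) :
    BddAbove (Set.range fun n => birkhoffSum T f n (T x)) ↔
      BddAbove (Set.range fun n => birkhoffSum T f n x) := by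
  simp only [bddAbove_def, Set.forall_mem_range]
  constructor
  · rintro ⟨R, hR⟩
    refine ⟨max 0 (f x + R), fun n => ?_⟩
    cases n with
    | zero => exact le_max_left _ _
    | succ n =>
      rw [birkhoffSum_succ']
      exact le_max_of_le_right (by linarith [hR n])
  · rintro ⟨R, hR⟩
    refine ⟨R - f x, fun n => ?_⟩
    have := hR (n + 1)
    rw [birkhoffSum_succ'] at this
    linarith

variable [MeasurableSpace X] {μ : Measure X}

lemma ae_all_iterate (hT : MeasurePreserving T μ μ) {p : X → Prop} (h : ∀ᵐ x ∂μ, p x) :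
    ∀ᵐ x ∂μ, ∀ n, p (T^[n] x) :=
  ae_all_iff.2 fun n => (hT.iterate n).quasiMeasurePreserving.ae h

lemma ae_forall_gt {p : ℝ → X → Prop} (hp : ∀ x q r, q ≤ r → p q x → p r x) {a : ℝ}
    (h : ∀ q > a, ∀ᵐ x ∂μ, p q x) : ∀ᵐ x ∂μ, ∀ q > a, p q x := by
  obtain ⟨u, -, hu, hlim⟩ := exists_seq_strictAnti_tendsto a
  filter_upwards [ae_all_iff.2 fun n => h (u n) (hu n)] with x hx q hq
  obtain ⟨n, hn⟩ := (hlim.eventually (gt_mem_nhds hq)).exists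
  exact hp x _ _ hn.le (hx n)

lemma measurable_birkhoffSum (hT : Measurable T) (hf : Measurable f) (n : ℕ) :
    Measurable (birkhoffSum T f n) :=
  Finset.measurable_fun_sum _ fun i _ => hf.comp (hT.iterate i)

lemma integral_birkhoffSum (hT : MeasurePreserving T μ μ) (hf : Integrable f μ) (n : ℕ) :
    ∫ x, birkhoffSum T f n x ∂μ = n * ∫ x, f x ∂μ := by
  have hiter : ∀ i, ∫ x, f (T^[i] x) ∂μ = ∫ x, f x ∂μ := fun i => by
    have hm := hf.aestronglyMeasurable
    rw [← (hT.iterate i).map_eq] at hm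
    rw [← integral_map (hT.iterate i).aemeasurable hm, (hT.iterate i).map_eq]
  calc ∫ x, birkhoffSum T f n x ∂μ = ∑ i ∈ Finset.range n, ∫ x, f (T^[i] x) ∂μ :=
        integral_finsetSum _ fun i _ => (hT.iterate i).integrable_comp_of_integrable hf
    _ = n * ∫ x, f x ∂μ := by
        simp only [hiter, Finset.sum_const, Finset.card_range, nsmul_eq_mul]

lemma measurable_maxBirkhoffSum (hT : Measurable T) (hf : Measurable f) (n : ℕ) :
    Measurable (maxBirkhoffSum T f n) := by
  induction n with
  | zero => exact measurable_const
  | succ n ih => exact measurable_const.max (hf.add (ih.comp hT))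

lemma measurableSet_maxBirkhoffSum_pos (hT : Measurable T) (hf : Measurable f) (n : ℕ) :
    MeasurableSet {x | 0 < maxBirkhoffSum T f n x} :=
  measurableSet_lt measurable_const (measurable_maxBirkhoffSum hT hf n)

lemma integrable_maxBirkhoffSum (hT : MeasurePreserving T μ μ) (hf : Integrable f μ) (n : ℕ) :
    Integrable (maxBirkhoffSum T f n) μ := by
  induction n with
  | zero => exact integrable_zero _ _ _
  | succ n ih =>
    exact (integrable_zero X ℝ μ).sup (hf.add (hT.integrable_comp_of_integrable ih))

theorem integral_indicator_maxBirkhoffSum_nonneg (hT : MeasurePreserving T μ μ)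
    (hfm : Measurable f) (hf : Integrable f μ) (n : ℕ) :
    0 ≤ ∫ x, {x | 0 < maxBirkhoffSum T f n x}.indicator f x ∂μ := by
  have hM := integrable_maxBirkhoffSum hT hf n
  have hMT : Integrable (fun x => maxBirkhoffSum T f n (T x)) μ :=
    hT.integrable_comp_of_integrable hM
  calc (0 : ℝ) = ∫ x, (maxBirkhoffSum T f n x - maxBirkhoffSum T f n (T x)) ∂μ := by
        have := integral_birkhoffSum hT hM 2
        simp only [birkhoffSum, Finset.sum_range_succ, Finset.range_zero, Finset.sum_empty,
          zero_add, Function.iterate_zero, id_eq, Function.iterate_one] at this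
        rw [integral_add hM hMT] at this
        rw [integral_sub hM hMT]
        push_cast at this
        linarith
    _ ≤ _ := integral_mono (hM.sub hMT)
        (hf.indicator (measurableSet_maxBirkhoffSum_pos hT.measurable hfm n))
        fun x => maxBirkhoffSum_sub_le_indicator n x

theorem integral_nonneg_of_ae_birkhoffSum_pos (hT : MeasurePreserving T μ μ) (hfm : Measurable f)
    (hf : Integrable f μ) (h : ∀ᵐ x ∂μ, ∃ n, 0 < birkhoffSum T f n x) : 0 ≤ ∫ x, f x ∂μ := by
  have hlim : Tendsto (fun n => ∫ x, {x | 0 < maxBirkhoffSum T f n x}.indicator f x ∂μ) atTop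
      (𝓝 (∫ x, f x ∂μ)) := by
    refine tendsto_integral_of_dominated_convergence (fun x => ‖f x‖)
      (fun n => (hf.indicator
        (measurableSet_maxBirkhoffSum_pos hT.measurable hfm n)).aestronglyMeasurable)
      hf.norm (fun n => Eventually.of_forall fun x => norm_indicator_le_norm_self _ _) ?_
    filter_upwards [h] with x ⟨n, hn⟩
    refine tendsto_const_nhds.congr' ?_
    filter_upwards [eventually_ge_atTop n] with m hm
    have hpos : 0 < maxBirkhoffSum T f m x :=
      (hn.trans_le (birkhoffSum_le_maxBirkhoffSum n x)).trans_le (monotone_maxBirkhoffSum x hm)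
    exact (Set.indicator_of_mem (by exact hpos) f).symm
  exact ge_of_tendsto' hlim fun n => integral_indicator_maxBirkhoffSum_nonneg hT hfm hf n

theorem ae_bddAbove_birkhoffSum (hT : Ergodic T μ) (hfm : Measurable f) (hf : Integrable f μ)
    (hneg : ∫ x, f x ∂μ < 0) : ∀ᵐ x ∂μ, BddAbove (Set.range fun n => birkhoffSum T f n x) := by
  refine (hT.ae_mem_or_ae_notMem
    (measurableSet_bddAbove_range fun n => measurable_birkhoffSum hT.measurable hfm n)
    (Set.ext fun x => bddAbove_birkhoffSum_comp_iff x)).resolve_right fun hunbdd => ?_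
  refine hneg.not_ge (integral_nonneg_of_ae_birkhoffSum_pos hT.toMeasurePreserving hfm hf ?_)
  filter_upwards [hunbdd] with x hx
  by_contra! hle
  exact hx ⟨0, Set.forall_mem_range.2 hle⟩

end Ergodic

section Averages

/-- The upper limit of the averages of `u` is at most `q`. Spelled out instead of using `limsup`,
which would come with boundedness side conditions. -/
def AvgLE (u : ℕ → ℝ) (q : ℝ) : Prop :=
  ∀ q' > q, ∀ᶠ N : ℕ in atTop, ∑ m ∈ Finset.range N, u m ≤ q' * N

variable {u v : ℕ → ℝ} {p q : ℝ}

lemma eventually_mul_add_le (h : p < q) (R : ℝ) : ∀ᶠ N : ℕ in atTop, p * N + R ≤ q * N := by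
  have hlim : Tendsto (fun N : ℕ => (q - p) * (N : ℝ)) atTop atTop :=
    tendsto_natCast_atTop_atTop.const_mul_atTop (sub_pos.2 h)
  filter_upwards [hlim.eventually_ge_atTop R] with N hN
  linarith

namespace AvgLE

lemma of_sum_le_add (R : ℝ) (h : ∀ᶠ N : ℕ in atTop, ∑ m ∈ Finset.range N, u m ≤ q * N + R) :
    AvgLE u q := fun q' hq' => by
  filter_upwards [h, eventually_mul_add_le hq' R] with N hN hR
  exact hN.trans hR

lemma of_forall_gt (h : ∀ q' > q, AvgLE u q') : AvgLE u q := fun q' hq' =>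
  h ((q + q') / 2) (by linarith) q' (by linarith)

lemma mono (hu : AvgLE u p) (h : p ≤ q) : AvgLE u q :=
  fun q' hq' => hu q' (h.trans_lt hq')

lemma add (hu : AvgLE u p) (hv : AvgLE v q) : AvgLE (fun m => u m + v m) (p + q) := by
  intro q' hq'
  filter_upwards [hu (p + (q' - p - q) / 2) (by linarith),
    hv (q + (q' - p - q) / 2) (by linarith)] with N hu hv
  rw [Finset.sum_add_distrib]
  linarith

lemma const_mul {c : ℝ} (hc : 0 < c) (hu : AvgLE u q) : AvgLE (fun m => c * u m) (c * q) := by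
  intro q' hq'
  filter_upwards [hu (q' / c) (by rwa [gt_iff_lt, lt_div_iff₀ hc, mul_comm])] with N h
  rw [← Finset.mul_sum]
  calc c * ∑ m ∈ Finset.range N, u m ≤ c * (q' / c * N) := mul_le_mul_of_nonneg_left h hc.le
    _ = q' * N := by field_simp

lemma of_eventually_le (hv : AvgLE v q) (h : ∀ᶠ m in atTop, u m ≤ v m) : AvgLE u q := by
  obtain ⟨M, hM⟩ := eventually_atTop.1 h
  refine of_forall_gt fun q' hq' => of_sum_le_add (∑ m ∈ Finset.range M, (u m - v m)) ?_
  filter_upwards [hv q' hq', eventually_ge_atTop M] with N hN hMN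
  have htail : ∑ m ∈ Finset.Ico M N, u m ≤ ∑ m ∈ Finset.Ico M N, v m :=
    Finset.sum_le_sum fun m hm => hM m (Finset.mem_Ico.1 hm).1
  rw [← Finset.sum_range_add_sum_Ico _ hMN] at hN ⊢
  rw [Finset.sum_sub_distrib]
  linarith

lemma tendsto (hu : ∀ m, 0 ≤ u m) (h : AvgLE u 0) :
    Tendsto (fun N : ℕ => (1 / (N : ℝ)) * ∑ m ∈ Finset.range N, u m) atTop (𝓝 0) := by
  refine tendsto_order.2 ⟨fun a ha => Eventually.of_forall fun N =>
    ha.trans_le (mul_nonneg (by positivity) (Finset.sum_nonneg fun m _ => hu m)), fun ε hε => ?_⟩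
  filter_upwards [h (ε / 2) (half_pos hε), eventually_gt_atTop 0] with N hN hN0
  have hN0' : (0 : ℝ) < N := Nat.cast_pos.2 hN0
  rw [one_div, inv_mul_lt_iff₀ hN0', mul_comm]
  exact hN.trans_lt (mul_lt_mul_of_pos_right (half_lt_self hε) hN0')

end AvgLE

lemma avgLE_const (c : ℝ) : AvgLE (fun _ => c) c :=
  AvgLE.of_sum_le_add 0 (Eventually.of_forall fun N => by simp [mul_comm])

section Ergodic

variable {X : Type*} {T : X → X} [MeasurableSpace X] {μ : Measure X} [IsProbabilityMeasure μ]

theorem ae_avgLE (hT : Ergodic T μ) {f : X → ℝ} (hfm : Measurable f) (hf : Integrable f μ) :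
    ∀ᵐ x ∂μ, AvgLE (fun m => f (T^[m] x)) (∫ x, f x ∂μ) := by
  have hbound : ∀ q > ∫ x, f x ∂μ, ∀ᵐ x ∂μ, AvgLE (fun m => f (T^[m] x)) q := by
    intro q hq
    have hneg : ∫ x, (f x - q) ∂μ < 0 := by
      rw [integral_sub hf (integrable_const q), integral_const, probReal_univ, one_smul]
      exact sub_neg.2 hq
    filter_upwards [ae_bddAbove_birkhoffSum hT (hfm.sub_const q) (hf.sub (integrable_const q)) hneg]
      with x ⟨R, hR⟩
    refine AvgLE.of_sum_le_add R (Eventually.of_forall fun N => ?_)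
    have hN := hR (Set.mem_range_self N)
    simp only [birkhoffSum, Finset.sum_sub_distrib, Finset.sum_const, Finset.card_range,
      nsmul_eq_mul] at hN
    linarith
  filter_upwards [ae_forall_gt (p := fun q x => AvgLE (fun m => f (T^[m] x)) q)
    (fun x q r hqr h => h.mono hqr) hbound] with x hx
  exact AvgLE.of_forall_gt hx

theorem ae_avgLE_indicator (hT : Ergodic T μ) {A : Set X} (hA : MeasurableSet A) :
    ∀ᵐ x ∂μ, AvgLE (fun m => A.indicator (1 : X → ℝ) (T^[m] x)) (μ.real A) := by
  have := ae_avgLE hT (measurable_one.indicator hA) ((integrable_const (1 : ℝ)).indicator hA)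
  rwa [← integral_indicator_one hA]

theorem ae_eventually_mul_le_card_visits (hT : Ergodic T μ) {A : Set X} (hA : MeasurableSet A)
    {q : ℝ} (hq : q < μ.real A) :
    ∀ᵐ x ∂μ, ∀ᶠ N : ℕ in atTop,
      q * N ≤ ∑ m ∈ Finset.range N, A.indicator (1 : X → ℝ) (T^[m] x) := by
  have := ae_avgLE hT (measurable_one.indicator hA).neg
    ((integrable_const (1 : ℝ)).indicator hA).neg
  filter_upwards [this] with x hx
  filter_upwards [hx (-q) (by
    simp only [Pi.neg_apply]
    rw [integral_neg, integral_indicator_one hA]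
    exact neg_lt_neg hq)] with N hN
  simp only [Pi.neg_apply, Finset.sum_neg_distrib] at hN
  linarith

/-- Egorov's theorem reduces the diagonal average to the frequency of visits to a small set. -/
theorem ae_avgLE_diagonal (hT : Ergodic T μ) {f : ℕ → X → ℝ} (hfm : ∀ m, Measurable (f m)) {C : ℝ}
    (hC : ∀ m, ∀ᵐ x ∂μ, f m x ≤ C) (hf : ∀ᵐ x ∂μ, Tendsto (fun m => f m x) atTop (𝓝 0)) :
    ∀ᵐ x ∂μ, AvgLE (fun m => f m (T^[m] x)) 0 := by
  set C' := max C 1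
  have hC'0 : 0 < C' := lt_max_of_lt_right one_pos
  have key : ∀ q > (0 : ℝ), ∀ᵐ x ∂μ, AvgLE (fun m => f m (T^[m] x)) q := by
    intro q hq
    obtain ⟨A, hA, hAq, hunif⟩ := tendstoUniformlyOn_of_ae_tendsto'
      (fun m => (hfm m).stronglyMeasurable) stronglyMeasurable_zero hf
      (show 0 < q / 2 / C' by positivity)
    have hAq' : C' * μ.real A ≤ q / 2 := by
      rw [mul_comm, ← le_div_iff₀ hC'0]
      exact ENNReal.toReal_le_of_le_ofReal (by positivity) hAq
    filter_upwards [ae_avgLE_indicator hT hA,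
      ae_all_iterate hT.toMeasurePreserving (ae_all_iff.2 hC)] with x hxA hxC
    refine (((avgLE_const (q / 2)).add (hxA.const_mul hC'0)).of_eventually_le ?_).mono
      (by linarith)
    filter_upwards [Metric.tendstoUniformlyOn_iff.1 hunif (q / 2) (half_pos hq)] with m hm
    by_cases hmem : T^[m] x ∈ A
    · rw [Set.indicator_of_mem hmem, Pi.one_apply]
      linarith [hxC m m, le_max_left C 1]
    · have := hm _ hmem
      rw [Pi.zero_apply, dist_zero_left, Real.norm_eq_abs] at this
      rw [Set.indicator_of_notMem hmem]
      linarith [le_abs_self (f m (T^[m] x))]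
  filter_upwards [ae_forall_gt (p := fun q x => AvgLE (fun m => f m (T^[m] x)) q)
    (fun x q r hqr h => h.mono hqr) key] with x hx
  exact AvgLE.of_forall_gt hx

end Ergodic

end Averages

section CondExp

lemma condExp_comp_comap {Ω Y : Type*} {m : MeasurableSpace Y} [mΩ : MeasurableSpace Ω]
    [mY : MeasurableSpace Y] {μ : Measure Ω} [IsFiniteMeasure μ] {φ : Ω → Y} (hφ : Measurable φ)
    (hm : m ≤ mY) {f : Y → ℝ} (hf : Integrable f (μ.map φ)) :
    μ[fun ω => f (φ ω) | m.comap φ] =ᵐ[μ] fun ω => ((μ.map φ)[f | m]) (φ ω) := by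
  have hle : m.comap φ ≤ mΩ := (MeasurableSpace.comap_mono hm).trans hφ.comap_le
  have hcond : Integrable ((μ.map φ)[f | m]) (μ.map φ) := integrable_condExp
  have hcond_comp : Integrable (fun ω => ((μ.map φ)[f | m]) (φ ω)) μ :=
    (integrable_map_measure hcond.aestronglyMeasurable hφ.aemeasurable).1 hcond
  have hf_comp : Integrable (fun ω => f (φ ω)) μ :=
    (integrable_map_measure hf.aestronglyMeasurable hφ.aemeasurable).1 hf
  symm
  refine ae_eq_condExp_of_forall_setIntegral_eq hle hf_comp
    (fun s _ _ => hcond_comp.integrableOn) ?_ ?_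
  · rintro s ⟨t, ht, rfl⟩ -
    rw [← setIntegral_map (hm t ht) hcond.aestronglyMeasurable hφ.aemeasurable,
      ← setIntegral_map (hm t ht) hf.aestronglyMeasurable hφ.aemeasurable]
    exact setIntegral_condExp hm hf ht
  · exact (stronglyMeasurable_condExp.comp_measurable (comap_measurable φ)).aestronglyMeasurable

variable {Ω : Type*} {m mΩ : MeasurableSpace Ω} {μ : Measure Ω}

lemma ae_abs_sub_condExp_le [IsFiniteMeasure μ] (hm : m ≤ mΩ) {f h : Ω → ℝ} (hf : Integrable f μ)
    (hh : StronglyMeasurable[m] h) {ε : ℝ} (hfh : ∀ᵐ ω ∂μ, |f ω - h ω| ≤ ε) :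
    ∀ᵐ ω ∂μ, |f ω - (μ[f | m]) ω| ≤ 2 * ε := by
  have hdiff : Integrable (f - h) μ :=
    .of_bound (hf.aestronglyMeasurable.sub (hh.mono hm).aestronglyMeasurable) ε hfh
  have hhi : Integrable h μ := by simpa using hf.sub hdiff
  have hcond : μ[f - h | m] =ᵐ[μ] μ[f | m] - h :=
    (condExp_sub hf hhi m).trans (by rw [condExp_of_stronglyMeasurable hm hh hhi])
  filter_upwards [hfh, hcond, ae_bdd_abs_condExp_of_ae_bdd_abs (m := m) (f := f - h) hfh]
    with ω hfω heq hle
  rw [heq, Pi.sub_apply, abs_sub_comm] at hle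
  linarith [abs_sub_le (f ω) (h ω) ((μ[f | m]) ω)]

lemma integral_mul_eq_zero_of_condExp_eq_zero (hm : m ≤ mΩ) [SigmaFinite (μ.trim hm)]
    {V D : Ω → ℝ} (hV : StronglyMeasurable[m] V) (hVD : Integrable (V * D) μ)
    (hD : Integrable D μ) (h0 : μ[D | m] =ᵐ[μ] 0) : ∫ ω, (V * D) ω ∂μ = 0 := by
  have hcond : μ[V * D | m] =ᵐ[μ] 0 := by
    filter_upwards [condExp_mul_of_stronglyMeasurable_left hV hVD hD, h0] with ω hmul h0
    rw [hmul, Pi.mul_apply, h0, Pi.zero_apply, mul_zero]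
  rw [← integral_condExp hm, integral_congr_ae hcond]
  exact integral_zero Ω ℝ

lemma condExp_indicator_smul_eq_zero {A : Set Ω} (hA : MeasurableSet[m] A) {D : Ω → ℝ}
    (hD : Integrable D μ) (h0 : μ[D | m] =ᵐ[μ] 0) (θ : ℝ) :
    μ[A.indicator (θ • D) | m] =ᵐ[μ] 0 := by
  filter_upwards [condExp_indicator (hD.smul θ) hA, condExp_smul θ D m, h0] with ω hind hsmul h0
  simp [hind, hsmul, h0]

end CondExp

section Martingale

lemma exp_sub_le_of_sq_le {y v : ℝ} (hy : |y| ≤ 1) (hv : y ^ 2 ≤ v) :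
    Real.exp (y - v) ≤ 1 + Real.exp (-v) * y := by
  have htaylor : Real.exp y ≤ 1 + v + y := by
    linarith [(abs_le.1 (Real.abs_exp_sub_one_sub_id_le hy)).2]
  have hinv : Real.exp (-v) * (1 + v) ≤ 1 := by
    rw [Real.exp_neg, inv_mul_le_iff₀ (Real.exp_pos _), mul_one, add_comm]
    exact Real.add_one_le_exp v
  calc Real.exp (y - v) = Real.exp (-v) * Real.exp y := by rw [← Real.exp_add, neg_add_eq_sub]
    _ ≤ Real.exp (-v) * (1 + v + y) := by gcongr
    _ ≤ 1 + Real.exp (-v) * y := by linarith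

variable {Ω : Type*} {mΩ : MeasurableSpace Ω} {μ : Measure Ω}

lemma ae_exp_sum_sub_le {D v : ℕ → Ω → ℝ} (hD1 : ∀ s, ∀ᵐ ω ∂μ, |D s ω| ≤ 1)
    (hDv : ∀ s, ∀ᵐ ω ∂μ, D s ω ^ 2 ≤ v s ω) (n : ℕ) :
    ∀ᵐ ω ∂μ, ‖Real.exp (∑ s ∈ Finset.range n, (D s ω - v s ω))‖ ≤ Real.exp n := by
  filter_upwards [ae_all_iff.2 hD1, ae_all_iff.2 hDv] with ω h1 hv
  rw [Real.norm_of_nonneg (Real.exp_pos _).le]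
  refine Real.exp_le_exp.2 ((Finset.sum_le_card_nsmul _ _ 1 fun s _ => ?_).trans (by simp))
  linarith [(abs_le.1 (h1 s)).2, hv s, sq_nonneg (D s ω)]

variable [IsProbabilityMeasure μ] {ℱ : Filtration ℕ mΩ} {D v : ℕ → Ω → ℝ}

lemma stronglyMeasurable_exp_sum_sub (hD : ∀ s, StronglyMeasurable[ℱ (s + 1)] (D s))
    (hv : ∀ s, StronglyMeasurable[ℱ s] (v s)) (n : ℕ) :
    StronglyMeasurable[ℱ n] fun ω => Real.exp (∑ s ∈ Finset.range n, (D s ω - v s ω)) :=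
  Real.continuous_exp.comp_stronglyMeasurable <| Finset.stronglyMeasurable_fun_sum _ fun s hs =>
    have hsn : s < n := Finset.mem_range.1 hs
    ((hD s).mono (ℱ.mono hsn)).sub ((hv s).mono (ℱ.mono hsn.le))

lemma integrable_exp_sum_sub (hD : ∀ s, StronglyMeasurable[ℱ (s + 1)] (D s))
    (hD1 : ∀ s, ∀ᵐ ω ∂μ, |D s ω| ≤ 1) (hv : ∀ s, StronglyMeasurable[ℱ s] (v s))
    (hDv : ∀ s, ∀ᵐ ω ∂μ, D s ω ^ 2 ≤ v s ω) (n : ℕ) :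
    Integrable (fun ω => Real.exp (∑ s ∈ Finset.range n, (D s ω - v s ω))) μ :=
  .of_bound ((stronglyMeasurable_exp_sum_sub hD hv n).mono (ℱ.le n)).aestronglyMeasurable _
    (ae_exp_sum_sub_le hD1 hDv n)

theorem integral_exp_sum_sub_le_one (hD : ∀ s, StronglyMeasurable[ℱ (s + 1)] (D s))
    (hD0 : ∀ s, μ[D s | ℱ s] =ᵐ[μ] 0) (hD1 : ∀ s, ∀ᵐ ω ∂μ, |D s ω| ≤ 1)
    (hv : ∀ s, StronglyMeasurable[ℱ s] (v s)) (hDv : ∀ s, ∀ᵐ ω ∂μ, D s ω ^ 2 ≤ v s ω) (n : ℕ) :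
    ∫ ω, Real.exp (∑ s ∈ Finset.range n, (D s ω - v s ω)) ∂μ ≤ 1 := by
  induction n with
  | zero => simp
  | succ n ih =>
    set W : Ω → ℝ := fun ω => Real.exp (∑ s ∈ Finset.range n, (D s ω - v s ω)) with hW
    set V : Ω → ℝ := fun ω => W ω * Real.exp (-v n ω) with hV
    have hVm : StronglyMeasurable[ℱ n] V := (stronglyMeasurable_exp_sum_sub hD hv n).mul
      (Real.continuous_exp.comp_stronglyMeasurable (hv n).neg)
    have hVb : ∀ᵐ ω ∂μ, ‖V ω‖ ≤ Real.exp n := by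
      filter_upwards [ae_exp_sum_sub_le hD1 hDv n, hDv n] with ω hWω hvω
      rw [norm_mul, Real.norm_of_nonneg (Real.exp_pos (-v n ω)).le]
      refine (mul_le_of_le_one_right (norm_nonneg _) (Real.exp_le_one_iff.2 ?_)).trans hWω
      linarith [sq_nonneg (D n ω)]
    have hDi : Integrable (D n) μ :=
      .of_bound ((hD n).mono (ℱ.le _)).aestronglyMeasurable 1 (hD1 n)
    have hVD : Integrable (V * D n) μ := hDi.bdd_mul (hVm.mono (ℱ.le n)).aestronglyMeasurable hVb
    have hWi : Integrable W μ := integrable_exp_sum_sub hD hD1 hv hDv n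
    calc ∫ ω, Real.exp (∑ s ∈ Finset.range (n + 1), (D s ω - v s ω)) ∂μ
        ≤ ∫ ω, (W ω + (V * D n) ω) ∂μ := by
          refine integral_mono_ae (integrable_exp_sum_sub hD hD1 hv hDv _) (hWi.add hVD) ?_
          filter_upwards [hD1 n, hDv n] with ω h1 hvω
          have hstep := mul_le_mul_of_nonneg_left (exp_sub_le_of_sq_le h1 hvω)
            (Real.exp_pos (∑ s ∈ Finset.range n, (D s ω - v s ω))).le
          rw [← Real.exp_add, ← Finset.sum_range_succ] at hstep
          refine hstep.trans_eq ?_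
          simp only [hV, hW, Pi.mul_apply]
          ring
      _ = ∫ ω, W ω ∂μ := by
          rw [integral_add hWi hVD,
            integral_mul_eq_zero_of_condExp_eq_zero (ℱ.le n) hVm hVD hDi (hD0 n), add_zero]
      _ ≤ 1 := ih

variable {A : ℕ → Set Ω} {B θ ε : ℝ}

lemma measureReal_le_sum_indicator_le (hA : ∀ s, MeasurableSet[ℱ s] (A s))
    (hD : ∀ s, StronglyMeasurable[ℱ (s + 1)] (D s)) (hD0 : ∀ s, μ[D s | ℱ s] =ᵐ[μ] 0)
    (hDB : ∀ s, ∀ᵐ ω ∂μ, |D s ω| ≤ B) (hθ : 0 ≤ θ) (hθB : θ * B ≤ 1) (a : ℝ) (n : ℕ) :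
    μ.real {ω | a ≤ ∑ s ∈ Finset.range n, (A s).indicator (fun ω => θ * D s ω - (θ * B) ^ 2) ω} ≤
      Real.exp (-a) := by
  set E : ℕ → Ω → ℝ := fun s => (A s).indicator (θ • D s) with hE
  set v : ℕ → Ω → ℝ := fun s => (A s).indicator fun _ => (θ * B) ^ 2 with hv
  have hθD : ∀ s, ∀ᵐ ω ∂μ, |θ * D s ω| ≤ θ * B := fun s => by
    filter_upwards [hDB s] with ω hω
    rw [abs_mul, abs_of_nonneg hθ]
    gcongr
  have hE_meas : ∀ s, StronglyMeasurable[ℱ (s + 1)] (E s) := fun s =>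
    ((hD s).const_smul θ).indicator (ℱ.mono s.le_succ _ (hA s))
  have hE_zero : ∀ s, μ[E s | ℱ s] =ᵐ[μ] 0 := fun s => condExp_indicator_smul_eq_zero (hA s)
    (.of_bound ((hD s).mono (ℱ.le _)).aestronglyMeasurable B (hDB s)) (hD0 s) θ
  have hE_le : ∀ s, ∀ᵐ ω ∂μ, |E s ω| ≤ 1 := fun s => by
    filter_upwards [hθD s] with ω hω
    by_cases hmem : ω ∈ A s
    · simpa only [hE, Set.indicator_of_mem hmem, Pi.smul_apply, smul_eq_mul] using hω.trans hθB
    · simp [hE, hmem]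
  have hv_meas : ∀ s, StronglyMeasurable[ℱ s] (v s) := fun s =>
    stronglyMeasurable_const.indicator (hA s)
  have hE_sq : ∀ s, ∀ᵐ ω ∂μ, E s ω ^ 2 ≤ v s ω := fun s => by
    filter_upwards [hθD s] with ω hω
    by_cases hmem : ω ∈ A s
    · simpa [hE, hv, hmem] using sq_le_sq' (abs_le.1 hω).1 (abs_le.1 hω).2
    · simp [hE, hv, hmem]
  have hsum : ∀ s ω, (A s).indicator (fun ω => θ * D s ω - (θ * B) ^ 2) ω = E s ω - v s ω :=
    fun s ω => by by_cases hmem : ω ∈ A s <;> simp [hE, hv, hmem]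
  simp only [hsum]
  have hmarkov := ProbabilityTheory.measure_ge_le_exp_mul_mgf (μ := μ)
    (X := fun ω => ∑ s ∈ Finset.range n, (E s ω - v s ω)) a zero_le_one
    (by simpa only [one_mul] using integrable_exp_sum_sub hE_meas hE_le hv_meas hE_sq n)
  simp only [ProbabilityTheory.mgf, one_mul, neg_one_mul] at hmarkov
  exact hmarkov.trans (mul_le_of_le_one_right (Real.exp_pos _).le
    (integral_exp_sum_sub_le_one hE_meas hE_zero hE_le hv_meas hE_sq n))

lemma measureReal_mul_lt_sum_indicator_le (hA : ∀ s, MeasurableSet[ℱ s] (A s))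
    (hD : ∀ s, StronglyMeasurable[ℱ (s + 1)] (D s)) (hD0 : ∀ s, μ[D s | ℱ s] =ᵐ[μ] 0)
    (hDB : ∀ s, ∀ᵐ ω ∂μ, |D s ω| ≤ B) (hθ : 0 ≤ θ) (hθB : θ * B ≤ 1) (hε : 2 * (θ * B ^ 2) ≤ ε)
    (n j : ℕ) :
    μ.real {ω | (j : ℝ) ≤ ∑ s ∈ Finset.range n, (A s).indicator 1 ω ∧
        ε * ∑ s ∈ Finset.range n, (A s).indicator 1 ω <
          ∑ s ∈ Finset.range n, (A s).indicator (D s) ω} ≤ Real.exp (-(θ * ε / 2) * j) := by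
  rw [neg_mul]
  refine (measureReal_mono fun ω hω => ?_).trans
    (measureReal_le_sum_indicator_le hA hD hD0 hDB hθ hθB (θ * ε / 2 * j) n)
  obtain ⟨hj, hlt⟩ := hω
  set M := ∑ s ∈ Finset.range n, (A s).indicator (1 : Ω → ℝ) ω
  set Z := ∑ s ∈ Finset.range n, (A s).indicator (D s) ω
  have hsum : ∑ s ∈ Finset.range n, (A s).indicator (fun ω => θ * D s ω - (θ * B) ^ 2) ω =
      θ * Z - (θ * B) ^ 2 * M := by
    rw [Finset.mul_sum, Finset.mul_sum, ← Finset.sum_sub_distrib]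
    refine Finset.sum_congr rfl fun s _ => ?_
    by_cases hmem : ω ∈ A s <;> simp [hmem]
  have hM : 0 ≤ M := j.cast_nonneg.trans hj
  have hε0 : 0 ≤ ε := le_trans (by positivity) hε
  calc θ * ε / 2 * j ≤ θ * ε / 2 * M := by gcongr
    _ = θ * (ε * M) - θ * M / 2 * ε := by ring
    _ ≤ θ * Z - θ * M / 2 * (2 * (θ * B ^ 2)) := by gcongr
    _ = _ := by rw [hsum]; ring

theorem measureReal_mul_lt_abs_sum_indicator_le (hA : ∀ s, MeasurableSet[ℱ s] (A s))
    (hD : ∀ s, StronglyMeasurable[ℱ (s + 1)] (D s)) (hD0 : ∀ s, μ[D s | ℱ s] =ᵐ[μ] 0)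
    (hDB : ∀ s, ∀ᵐ ω ∂μ, |D s ω| ≤ B) (hθ : 0 ≤ θ) (hθB : θ * B ≤ 1) (hε : 2 * (θ * B ^ 2) ≤ ε)
    (n j : ℕ) :
    μ.real {ω | (j : ℝ) ≤ ∑ s ∈ Finset.range n, (A s).indicator 1 ω ∧
        ε * ∑ s ∈ Finset.range n, (A s).indicator 1 ω <
          |∑ s ∈ Finset.range n, (A s).indicator (D s) ω|} ≤
      2 * Real.exp (-(θ * ε / 2) * j) := by
  have hupper := measureReal_mul_lt_sum_indicator_le hA hD hD0 hDB hθ hθB hε n j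
  have hlower := measureReal_mul_lt_sum_indicator_le (D := fun s => -D s) hA
    (fun s => (hD s).neg) (fun s => by
      filter_upwards [condExp_neg (D s) (ℱ s), hD0 s] with ω hneg h0
      rw [hneg, Pi.neg_apply, h0, Pi.zero_apply, neg_zero])
    (fun s => by simpa only [Pi.neg_apply, abs_neg] using hDB s) hθ hθB hε n j
  rw [two_mul]
  refine (measureReal_mono fun ω hω => ?_).trans ((measureReal_union_le _ _).trans
    (add_le_add hupper hlower))
  refine (lt_abs.1 hω.2).imp (fun h => ⟨hω.1, h⟩) fun h => ⟨hω.1, h.trans_eq ?_⟩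
  rw [← Finset.sum_neg_distrib]
  exact Finset.sum_congr rfl fun s _ => by
    rw [Set.indicator_neg', Pi.neg_apply]

end Martingale

section Canonical

variable {α : Type*}

/-- The coordinate process on the space of two-sided sequences. -/
def coord (i : ℤ) (x : ℤ → α) : α := x i

@[simp] lemma coord_apply (i : ℤ) (x : ℤ → α) : coord i x = x i := rfl

lemma path_coord (x : ℤ → α) : path coord x = x := rfl

lemma shift_iterate_apply (n : ℕ) (x : ℤ → α) (i : ℤ) : (shift^[n] x) i = x (i + n) := by
  induction n generalizing x with
  | zero => simp
  | succ n ih =>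
    rw [Function.iterate_succ_apply, ih, shift]
    congr 1
    push_cast
    ring

lemma word_shift_iterate (x : ℤ → α) (k a : ℕ) (i : ℤ) :
    word (shift^[a] x) k i = word x k (i + a) := by
  funext j
  rw [word, shift_iterate_apply, word, sub_add_eq_add_sub]

lemma matchTimes_shift_iterate (x : ℤ → α) (k n a : ℕ) :
    matchTimes (shift^[a] x) k n = visits (fun s => word x k ((s + a : ℕ) : ℤ)) (k - 1) n := by
  simp only [matchTimes, word_shift_iterate, Nat.cast_add]

variable [MeasurableSpace α]

lemma measurable_shift : Measurable (shift (α := α)) :=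
  measurable_pi_lambda _ fun i => measurable_pi_apply (i + 1)

lemma measurable_coord (i : ℤ) : Measurable (coord (α := α) i) := measurable_pi_apply i

section SigmaOf

variable {Ω : Type*} (X : ℤ → Ω → α) {s t : Set ℤ} {i : ℤ}

lemma sigmaOf_eq_iSup (s : Set ℤ) :
    sigmaOf X s = ⨆ i : s, MeasurableSpace.comap (X i) inferInstance := by
  simp only [sigmaOf, MeasurableSpace.pi, MeasurableSpace.comap_iSup, MeasurableSpace.comap_comp]
  rfl

lemma comap_le_sigmaOf (hi : i ∈ s) : MeasurableSpace.comap (X i) inferInstance ≤ sigmaOf X s := by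
  rw [sigmaOf_eq_iSup]
  exact le_iSup (fun i : s => MeasurableSpace.comap (X i) inferInstance) ⟨i, hi⟩

lemma measurable_sigmaOf (hi : i ∈ s) : Measurable[sigmaOf X s] (X i) :=
  measurable_iff_comap_le.2 (comap_le_sigmaOf X hi)

lemma sigmaOf_mono (h : s ⊆ t) : sigmaOf X s ≤ sigmaOf X t := by
  rw [sigmaOf_eq_iSup X s]
  exact iSup_le fun i => comap_le_sigmaOf X (h i.2)

lemma comap_path_sigmaOf (s : Set ℤ) : (sigmaOf coord s).comap (path X) = sigmaOf X s := by
  simp only [sigmaOf, MeasurableSpace.comap_comp]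
  rfl

lemma sigmaOf_coord_le (s : Set ℤ) :
    sigmaOf (coord (α := α)) s ≤ (inferInstance : MeasurableSpace (ℤ → α)) := by
  rw [sigmaOf_eq_iSup]
  exact iSup_le fun i => (measurable_coord (i : ℤ)).comap_le

lemma comap_shift_sigmaOf (n : ℕ) (h : ∀ i, i ∈ s ↔ i + n ∈ t) :
    (sigmaOf (coord (α := α)) s).comap shift^[n] = sigmaOf coord t := by
  have hcoord (i : ℤ) : coord (α := α) i ∘ shift^[n] = coord (i + n) :=
    funext fun x => shift_iterate_apply n x i
  simp only [sigmaOf_eq_iSup, MeasurableSpace.comap_iSup, MeasurableSpace.comap_comp, hcoord]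
  refine le_antisymm (iSup_le fun i => ?_) (iSup_le fun i => ?_)
  · exact le_iSup (fun i : t => MeasurableSpace.comap (coord (α := α) i) inferInstance)
      ⟨_, (h i).1 i.2⟩
  · have hi : (i : ℤ) - n ∈ s := (h _).2 (by simp)
    simpa using le_iSup
      (fun i : s => MeasurableSpace.comap (coord (α := α) (i + n)) inferInstance) ⟨_, hi⟩

lemma iSup_sigmaOf_Icc :
    ⨆ m : ℕ, sigmaOf (coord (α := α)) (Set.Icc (-(m : ℤ)) 0) = sigmaOf coord (Set.Iic 0) := by
  refine le_antisymm (iSup_le fun m => sigmaOf_mono _ fun i hi => hi.2) ?_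
  rw [sigmaOf_eq_iSup coord (Set.Iic 0), iSup_le_iff]
  intro i
  have hi : (i : ℤ) ≤ 0 := i.2
  exact le_iSup_of_le (-(i : ℤ)).toNat (comap_le_sigmaOf _ ⟨by omega, hi⟩)

/-- The σ-algebras generated by the letters up to a given time. -/
def pastFiltration (α : Type*) [MeasurableSpace α] :
    Filtration ℕ (inferInstance : MeasurableSpace (ℤ → α)) where
  seq n := sigmaOf coord (Set.Iic (n : ℤ))
  mono' _ _ hmn := sigmaOf_mono _ (Set.Iic_subset_Iic.2 (by exact_mod_cast hmn))
  le' _ := sigmaOf_coord_le _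

/-- The σ-algebras generated by the letters between a given negative time and time `0`. -/
def windowFiltration (α : Type*) [MeasurableSpace α] :
    Filtration ℕ (inferInstance : MeasurableSpace (ℤ → α)) where
  seq m := sigmaOf coord (Set.Icc (-(m : ℤ)) 0)
  mono' _ _ hmn := sigmaOf_mono _ (Set.Icc_subset_Icc (by omega) le_rfl)
  le' _ := sigmaOf_coord_le _

lemma measurable_word (k : ℕ) (i : ℤ) :
    Measurable[sigmaOf coord (Set.Iic i)] fun x : ℤ → α => word x k i :=
  @measurable_pi_lambda _ _ _ (sigmaOf coord (Set.Iic i)) _ _ fun j =>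
    measurable_sigmaOf coord (i := i - (j : ℕ)) (by simp)

end SigmaOf

variable [Finite α] [MeasurableSingletonClass α]

lemma measurable_sum_matchTimes (k n : ℕ) {f : ℕ → (ℤ → α) → ℝ} (hf : ∀ s, Measurable (f s)) :
    Measurable fun x : ℤ → α => ∑ s ∈ matchTimes x k n, f s x := by
  have hword (i : ℤ) : Measurable fun x : ℤ → α => word x k i :=
    (measurable_word k i).mono (sigmaOf_coord_le _) le_rfl
  simp only [matchTimes, visits, Finset.sum_filter]
  exact Finset.measurable_fun_sum _ fun s _ =>
    (hf s).ite (measurableSet_eq_fun (hword s) (hword n)) measurable_const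

lemma measurable_card_matchTimes (k n : ℕ) :
    Measurable fun x : ℤ → α => (#(matchTimes x k n) : ℝ) := by
  simpa using measurable_sum_matchTimes (α := α) k n (f := fun _ _ => 1) fun _ => measurable_const

end Canonical

section ConditionalMeans

variable {α : Type*} [MeasurableSpace α]

/-- `E(g(X_1) | X_{-∞}^0)` for the coordinate process. -/
def pastMean (ν : Measure (ℤ → α)) (g : α → ℝ) : (ℤ → α) → ℝ :=
  ν[fun x => g (x 1) | sigmaOf coord (Set.Iic 0)]

/-- `E(g(X_1) | X_{-m}^0)` for the coordinate process. -/
def recentMean (ν : Measure (ℤ → α)) (g : α → ℝ) (m : ℕ) : (ℤ → α) → ℝ :=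
  ν[fun x => g (x 1) | sigmaOf coord (Set.Icc (-(m : ℤ)) 0)]

/-- The distance between the conditional means given the whole past and given `X_{-m}^0`. -/
def meanGap (ν : Measure (ℤ → α)) (g : α → ℝ) (m : ℕ) (x : ℤ → α) : ℝ :=
  |pastMean ν g x - recentMean ν g m x|

/-- The distance between the estimator at time `n` and `E(g(X_1) | X_{-n}^0)` evaluated at the
sequence shifted to time `n`; by stationarity this is the error of the coordinate process. -/
def predictionError [Fintype α] (ν : Measure (ℤ → α)) (g : α → ℝ) (n : ℕ) (x : ℤ → α) : ℝ :=
  |estimator g x n - recentMean ν g n (shift^[n] x)|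

variable {ν : Measure (ℤ → α)} (g : α → ℝ)

omit [MeasurableSpace α] in
lemma exists_pos_forall_abs_le [Finite α] : ∃ C > 0, ∀ a, |g a| ≤ C := by
  obtain ⟨C, hC⟩ := (Set.finite_range fun a => |g a|).bddAbove
  exact ⟨max C 1, lt_max_of_lt_right one_pos,
    fun a => (hC (Set.mem_range_self a)).trans (le_max_left C 1)⟩

lemma measurable_pastMean : Measurable (pastMean ν g) :=
  (stronglyMeasurable_condExp.mono (sigmaOf_coord_le _)).measurable

lemma measurable_recentMean (m : ℕ) : Measurable (recentMean ν g m) :=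
  (stronglyMeasurable_condExp.mono (sigmaOf_coord_le _)).measurable

lemma recentMean_eq_of_word_eq {m : ℕ} {x y : ℤ → α}
    (h : word x (m + 1) 0 = word y (m + 1) 0) : recentMean ν g m x = recentMean ν g m y := by
  have hmeas : StronglyMeasurable[sigmaOf coord (Set.Icc (-(m : ℤ)) 0)] (recentMean ν g m) :=
    stronglyMeasurable_condExp
  refine hmeas.factorsThrough (funext fun ⟨i, hi1, hi2⟩ => ?_)
  have hi : (0 : ℤ) - ((-i).toNat : ℕ) = i := by omega
  simpa only [word, coord, hi] using congrFun h ⟨(-i).toNat, by omega⟩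

lemma predictionError_nonneg [Fintype α] (n : ℕ) (x : ℤ → α) : 0 ≤ predictionError ν g n x :=
  abs_nonneg _

lemma meanGap_nonneg (m : ℕ) (x : ℤ → α) : 0 ≤ meanGap ν g m x := abs_nonneg _

lemma measurable_meanGap (m : ℕ) : Measurable (meanGap ν g m) :=
  ((measurable_pastMean g).sub (measurable_recentMean g m)).abs

lemma integrable_meanGap (m : ℕ) : Integrable (meanGap ν g m) ν :=
  (integrable_condExp.sub integrable_condExp).abs

section Bounds

variable {g} {C : ℝ} (hg : ∀ a, |g a| ≤ C)

include hg

lemma ae_abs_recentMean_le (m : ℕ) : ∀ᵐ x ∂ν, |recentMean ν g m x| ≤ C :=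
  ae_bdd_abs_condExp_of_ae_bdd_abs (ae_of_all _ fun x => hg (x 1))

lemma ae_meanGap_le (m : ℕ) : ∀ᵐ x ∂ν, meanGap ν g m x ≤ 2 * C := by
  have hpast : ∀ᵐ x ∂ν, |pastMean ν g x| ≤ C :=
    ae_bdd_abs_condExp_of_ae_bdd_abs (ae_of_all _ fun x => hg (x 1))
  filter_upwards [hpast, ae_abs_recentMean_le (ν := ν) hg m] with x hpast hrecent
  rw [meanGap]
  linarith [abs_sub (pastMean ν g x) (recentMean ν g m x)]

end Bounds

lemma ae_tendsto_meanGap [IsFiniteMeasure ν] :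
    ∀ᵐ x ∂ν, Tendsto (fun m => meanGap ν g m x) atTop (𝓝 0) := by
  have hlevy := tendsto_ae_condExp (μ := ν) (ℱ := windowFiltration α) fun x => g (x 1)
  rw [show ⨆ m, windowFiltration α m = sigmaOf coord (Set.Iic 0) from iSup_sigmaOf_Icc] at hlevy
  filter_upwards [hlevy] with x hx
  change Tendsto (fun m => recentMean ν g m x) atTop (𝓝 (pastMean ν g x)) at hx
  simpa [meanGap] using (tendsto_const_nhds (x := pastMean ν g x)).sub hx |>.abs

variable [Finite α]

lemma tendsto_integral_meanGap [IsFiniteMeasure ν] :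
    Tendsto (fun m => ∫ x, meanGap ν g m x ∂ν) atTop (𝓝 0) := by
  obtain ⟨C, -, hC⟩ := exists_pos_forall_abs_le g
  simpa using tendsto_integral_of_dominated_convergence (f := fun _ => 0) (fun _ => 2 * C)
    (fun m => (measurable_meanGap g m).aestronglyMeasurable) (integrable_const _)
    (fun m => by
      filter_upwards [ae_meanGap_le (ν := ν) hC m] with x hx
      rwa [Real.norm_of_nonneg (meanGap_nonneg g m x)]) (ae_tendsto_meanGap g)

section Stationary

variable [IsFiniteMeasure ν] [MeasurableSingletonClass α]

lemma integrable_comp_apply (i : ℤ) : Integrable (fun x : ℤ → α => g (x i)) ν :=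
  (Integrable.of_finite (μ := ν.map (fun x : ℤ → α => x i)) (f := g)).comp_measurable
    (measurable_pi_apply i)

variable (hT : MeasurePreserving shift ν ν)

include hT

lemma condExp_shift (n : ℕ) {s t : Set ℤ} (h : ∀ i, i ∈ s ↔ i + n ∈ t) :
    ν[fun x => g (x ((n : ℤ) + 1)) | sigmaOf coord t] =ᵐ[ν]
      fun x => (ν[fun x => g (x 1) | sigmaOf coord s]) (shift^[n] x) := by
  have hTn := hT.iterate n
  have hcomap := condExp_comp_comap (μ := ν) (φ := shift^[n]) hTn.measurable
    (sigmaOf_coord_le (α := α) s) (f := fun x => g (x 1))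
    (by rw [hTn.map_eq]; exact integrable_comp_apply g 1)
  rw [hTn.map_eq, comap_shift_sigmaOf n h] at hcomap
  simpa only [shift_iterate_apply, add_comm] using hcomap

lemma condExp_Iic_eq (n : ℕ) :
    ν[fun x => g (x ((n : ℤ) + 1)) | sigmaOf coord (Set.Iic (n : ℤ))] =ᵐ[ν]
      fun x => pastMean ν g (shift^[n] x) :=
  condExp_shift g hT n fun i => by simp

omit [Finite α] in
lemma ae_error_eq [Fintype α] :
    ∀ᵐ x ∂ν, ∀ n : ℕ, error ν coord g n x = predictionError ν g n x := by
  refine ae_all_iff.2 fun n => ?_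
  have hcond := condExp_shift g hT n (s := Set.Icc (-(n : ℤ)) 0) (t := Set.Icc 0 (n : ℤ))
    fun i => by simp only [Set.mem_Icc]; omega
  filter_upwards [hcond] with x hx
  simp only [error, path_coord, coord_apply, hx, predictionError, recentMean]

end Stationary

end ConditionalMeans

section ExceptionalSets

variable {α : Type*} [Fintype α]

/-- The realizations for which the last `K α n` letters at time `n` have few earlier occurrences. -/
def scarceSet (α : Type*) [Fintype α] (n : ℕ) : Set (ℤ → α) :=
  {x | #(matchTimes x (K α n) n) < J n}

/-- The realizations for which the average of `D` over the earlier occurrences of the last `K α n`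
letters at time `n` exceeds `ε`. -/
def largeAverageSet (D : (ℤ → α) → ℝ) (ε : ℝ) (n : ℕ) : Set (ℤ → α) :=
  {x | ε * #(matchTimes x (K α n) n) < ∑ s ∈ matchTimes x (K α n) n, D (shift^[s] x)}

lemma card_words_le [Nonempty α] {k l : ℕ} (h : k ≤ l) :
    Fintype.card (Fin k → α) ≤ Fintype.card α ^ l := by
  rw [Fintype.card_fun, Fintype.card_fin]
  exact Nat.pow_le_pow_right Fintype.card_pos h

section Counting

open Classical

lemma card_scarce_le [Nonempty α] (x : ℤ → α) (N : ℕ) :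
    #{m ∈ Finset.range N | x ∈ scarceSet α m} ≤
      (K α N + 1) * (Fintype.card α ^ K α N * J N + K α N) := by
  have hlevel : ∀ k ∈ Finset.range (K α N + 1),
      #{m ∈ {m ∈ Finset.range N | x ∈ scarceSet α m} | K α m = k} ≤
        Fintype.card α ^ K α N * J N + K α N := by
    intro k hk
    have hkN : k ≤ K α N := Finset.mem_range_succ_iff.1 hk
    have hfew := card_le_of_few_visits_of_le_add (fun m : ℕ => word x k m) (b := k - 1) (l := k)
      (j := J N) (B := {m ∈ {m ∈ Finset.range N | x ∈ scarceSet α m} | K α m = k})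
      (fun m _ => by omega) fun m hm => by
        simp only [Finset.mem_filter, Finset.mem_range] at hm
        obtain ⟨⟨hmN, hscarce⟩, rfl⟩ := hm
        exact lt_of_lt_of_le hscarce (J_mono hmN.le)
    exact hfew.trans (Nat.add_le_add (Nat.mul_le_mul_right _ (card_words_le hkN)) hkN)
  refine (Finset.card_le_mul_card_image_of_maps_to (fun m hm => ?_) _ hlevel).trans_eq
    (by rw [Finset.card_range, mul_comm])
  exact Finset.mem_range_succ_iff.2
    (K_mono α (Finset.mem_range.1 (Finset.mem_filter.1 hm).1).le)

lemma card_scarce_shift_le [Nonempty α] (x : ℤ → α) (n : ℕ) :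
    #{a ∈ Finset.range n | shift^[a] x ∈ scarceSet α n} ≤
      Fintype.card α ^ K α n * J n + K α n := by
  set k := K α n
  set A : Finset ℕ := {a ∈ Finset.range n | shift^[a] x ∈ scarceSet α n}
  have hfew := card_le_of_few_visits_of_le_add (fun m : ℕ => word x k m) (b := k - 1 + n) (l := k)
    (j := J n) (B := A.map (addLeftEmbedding n)) (fun m hm => ?_) fun m hm => ?_
  · rw [Finset.card_map] at hfew
    exact hfew.trans (Nat.add_le_add_right (Nat.mul_le_mul_right _ (card_words_le le_rfl)) _)
  · obtain ⟨a, -, rfl⟩ := Finset.mem_map.1 hm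
    rw [addLeftEmbedding_apply]
    omega
  · obtain ⟨a, ha, rfl⟩ := Finset.mem_map.1 hm
    obtain ⟨han, hscarce⟩ := Finset.mem_filter.1 ha
    have hvisits : #(visits (fun m : ℕ => word x k m) (k - 1 + a) (n + a)) < J n := by
      rw [← card_visits_add, ← matchTimes_shift_iterate]
      exact hscarce
    refine (Finset.card_le_card fun s hs => ?_).trans_lt hvisits
    rw [mem_visits] at hs ⊢
    exact ⟨⟨by grind, hs.1.2⟩, hs.2⟩

section LargeAverage

variable (x : ℤ → α) {D : (ℤ → α) → ℝ} (hD : ∀ x, 0 ≤ D x) {ε : ℝ} (hε : 0 ≤ ε)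

include hD hε

lemma mul_card_largeAverage_level_le (N k : ℕ) :
    ε * #{m ∈ Finset.range N | x ∈ largeAverageSet D ε m ∧ K α m = k} ≤
      ∑ s ∈ Finset.range N, D (shift^[s] x) := by
  refine mul_card_le_sum_range (fun m : ℕ => word x k m) (fun s => hD _) hε (fun _ => k - 1)
    (fun m hm => ?_) fun m hm => ?_
  · exact (Finset.mem_range.1 (Finset.mem_filter.1 hm).1).le
  · obtain ⟨-, hlarge, rfl⟩ := Finset.mem_filter.1 hm
    exact hlarge

lemma mul_card_largeAverage_shift_le (n : ℕ) :
    ε * #{a ∈ Finset.range n | shift^[a] x ∈ largeAverageSet D ε n} ≤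
      ∑ s ∈ Finset.range (2 * n), D (shift^[s] x) := by
  set k := K α n
  rw [← Finset.card_map (addLeftEmbedding n)]
  refine mul_card_le_sum_range (fun m : ℕ => word x k m) (fun s => hD _) hε
    (fun m => k - 1 + (m - n)) (fun m hm => ?_) fun m hm => ?_
  · obtain ⟨a, ha, rfl⟩ := Finset.mem_map.1 hm
    have := Finset.mem_range.1 (Finset.mem_filter.1 ha).1
    rw [addLeftEmbedding_apply]
    omega
  · obtain ⟨a, ha, rfl⟩ := Finset.mem_map.1 hm
    have hlarge : ε * #(matchTimes (shift^[a] x) k n) <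
        ∑ s ∈ matchTimes (shift^[a] x) k n, D (shift^[s] (shift^[a] x)) :=
      (Finset.mem_filter.1 ha).2
    simp only [← Function.iterate_add_apply] at hlarge
    rw [matchTimes_shift_iterate, card_visits_add (fun m : ℕ => word x k m),
      sum_visits_add (fun m : ℕ => word x k m) _ _ _ fun s => D (shift^[s] x)] at hlarge
    simpa only [addLeftEmbedding_apply, Nat.add_sub_cancel_left] using hlarge

/-- Since `K` is logarithmic, it takes at most `L + 1` values on the times in `[η * N, N)`. -/
lemma mul_card_largeAverage_le {η : ℝ} (hη : 0 < η) {L : ℕ}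
    (hL : ∀ N m : ℕ, η * N ≤ m → K α N ≤ K α m + L) (N : ℕ) :
    ε * #{m ∈ Finset.range N | x ∈ largeAverageSet D ε m} ≤
      ε * (η * N + 1) + (L + 1) * ∑ s ∈ Finset.range N, D (shift^[s] x) := by
  set M := ⌈η * N⌉₊
  set B : ℕ → Finset ℕ :=
    fun k => {m ∈ Finset.range N | x ∈ largeAverageSet D ε m ∧ K α m = k}
  set levels := Finset.Icc (K α N - L) (K α N) with hlevels
  have hsub : {m ∈ Finset.range N | x ∈ largeAverageSet D ε m} ⊆
      Finset.range M ∪ levels.biUnion B := by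
    intro m hm
    obtain ⟨hmN, hlarge⟩ := Finset.mem_filter.1 hm
    rcases lt_or_ge m M with hlt | hge
    · exact Finset.mem_union_left _ (Finset.mem_range.2 hlt)
    · have hKm := hL N m ((Nat.le_ceil _).trans (by exact_mod_cast hge))
      refine Finset.mem_union_right _ (Finset.mem_biUnion.2 ⟨K α m, Finset.mem_Icc.2 ⟨by omega,
        K_mono α (Finset.mem_range.1 hmN).le⟩, Finset.mem_filter.2 ⟨hmN, hlarge, rfl⟩⟩)
  have hcard : (#{m ∈ Finset.range N | x ∈ largeAverageSet D ε m} : ℝ) ≤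
      M + ∑ k ∈ levels, (#(B k) : ℝ) := by
    have := (Finset.card_le_card hsub).trans ((Finset.card_union_le _ _).trans
      (Nat.add_le_add_left Finset.card_biUnion_le _))
    rw [Finset.card_range] at this
    exact_mod_cast this
  have hlevels_card : (#levels : ℝ) ≤ L + 1 := by
    rw [hlevels, Nat.card_Icc]
    exact_mod_cast (by omega : K α N + 1 - (K α N - L) ≤ L + 1)
  calc ε * (#{m ∈ Finset.range N | x ∈ largeAverageSet D ε m} : ℝ)
      ≤ ε * M + ∑ k ∈ levels, ε * (#(B k) : ℝ) := by
        rw [← Finset.mul_sum, ← mul_add]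
        gcongr
    _ ≤ ε * (η * N + 1) + ∑ _k ∈ levels, ∑ s ∈ Finset.range N, D (shift^[s] x) := by
        gcongr
        · exact (Nat.ceil_lt_add_one (by positivity)).le
        · exact mul_card_largeAverage_level_le x hD hε N k
    _ ≤ _ := by
        rw [Finset.sum_const, nsmul_eq_mul]
        gcongr
        exact Finset.sum_nonneg fun s _ => hD _

end LargeAverage

end Counting

lemma avgLE_indicator_scarceSet [Nonempty α] (x : ℤ → α) :
    AvgLE (fun m => (scarceSet α m).indicator 1 x) 0 := by
  classical
  intro q hq
  filter_upwards [(tendsto_words_mul_J_div α).eventually (gt_mem_nhds hq),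
    eventually_ge_atTop 1] with N hN hN1
  rw [div_lt_iff₀ (by exact_mod_cast hN1)] at hN
  simp only [Set.indicator_apply, Pi.one_apply, Finset.sum_boole]
  exact le_trans (by exact_mod_cast card_scarce_le x N) hN.le

lemma avgLE_indicator_largeAverageSet {x : ℤ → α} {D : (ℤ → α) → ℝ} (hD : ∀ x, 0 ≤ D x) {ε : ℝ}
    (hε : 0 < ε) {η : ℝ} (hη : 0 < η) {L : ℕ} (hL : ∀ N m : ℕ, η * N ≤ m → K α N ≤ K α m + L)
    {d : ℝ} (hd : AvgLE (fun m => D (shift^[m] x)) d) :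
    AvgLE (fun m => (largeAverageSet D ε m).indicator 1 x) (η + (L + 1) / ε * d) := by
  classical
  refine .of_forall_gt fun q hq => .of_sum_le_add 1 ?_
  filter_upwards [((avgLE_const η).add (hd.const_mul (c := (L + 1) / ε) (by positivity))) q hq]
    with N hN
  have hcard := mul_card_largeAverage_le x hD hε.le hη hL N
  simp only [Finset.sum_add_distrib, Finset.sum_const, Finset.card_range, nsmul_eq_mul,
    ← Finset.mul_sum] at hN
  simp only [Set.indicator_apply, Pi.one_apply, Finset.sum_boole]
  rw [← le_div_iff₀' hε] at hcard
  calc _ ≤ _ := hcard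
    _ = N * η + (L + 1) / ε * ∑ s ∈ Finset.range N, D (shift^[s] x) + 1 := by
        field_simp
        ring
    _ ≤ q * N + 1 := by gcongr

end ExceptionalSets

section Probability

open Classical in
lemma mul_measureReal_le_integral {Ω : Type*} [MeasurableSpace Ω] {μ : Measure Ω}
    [IsFiniteMeasure μ] {T : Ω → Ω} (hT : MeasurePreserving T μ μ) {A : Set Ω}
    (hA : MeasurableSet A) {F : Ω → ℝ} (hF : Integrable F μ) {n : ℕ} {c : ℝ}
    (h : ∀ x, c * #{a ∈ Finset.range n | T^[a] x ∈ A} ≤ F x) :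
    c * (n * μ.real A) ≤ ∫ x, F x ∂μ := by
  have hind : Integrable (A.indicator (1 : Ω → ℝ)) μ := (integrable_const 1).indicator hA
  rw [← integral_indicator_one hA, ← integral_birkhoffSum hT hind, ← integral_const_mul]
  refine integral_mono (.const_mul ?_ c) hF fun x => ?_
  · exact integrable_finsetSum _ fun a _ => (hT.iterate a).integrable_comp_of_integrable hind
  · simpa only [birkhoffSum, Set.indicator_apply, Pi.one_apply, Finset.sum_boole] using h x

section Occurrences

variable {α : Type*} [MeasurableSpace α] [Finite α] [MeasurableSingletonClass α]
  {ν : Measure (ℤ → α)} (g : α → ℝ)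

/-- The realizations for which the word `w` occurs at time `s` inside `x_0, …, x_s`. -/
def occurrenceSet (k : ℕ) (w : Fin k → α) (s : ℕ) : Set (ℤ → α) :=
  {x | k ≤ s + 1 ∧ word x k s = w}

/-- The difference between `g (x_{s+1})` and its conditional mean given the letters up to
time `s`. -/
def innovation (ν : Measure (ℤ → α)) (g : α → ℝ) (s : ℕ) (x : ℤ → α) : ℝ :=
  g (x ((s : ℤ) + 1)) - (ν[fun y => g (y ((s : ℤ) + 1)) | pastFiltration α s]) x

omit [Finite α] in
lemma measurableSet_occurrenceSet (k : ℕ) (w : Fin k → α) (s : ℕ) :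
    MeasurableSet[pastFiltration α s] (occurrenceSet k w s) :=
  (MeasurableSet.const _).inter (measurable_word k s (measurableSet_singleton w))

omit [MeasurableSpace α] [Finite α] [MeasurableSingletonClass α] in
lemma sum_matchTimes_eq_sum_indicator (x : ℤ → α) (k n : ℕ) (f : ℕ → (ℤ → α) → ℝ) :
    ∑ s ∈ matchTimes x k n, f s x =
      ∑ s ∈ Finset.range n, (occurrenceSet k (word x k n) s).indicator (f s) x := by
  classical
  simp only [Set.indicator_apply, ← Finset.sum_filter]
  refine Finset.sum_congr (Finset.ext fun s => ?_) fun _ _ => rfl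
  rw [mem_matchTimes, Finset.mem_filter, Finset.mem_range, and_comm (a := k ≤ s + 1), and_assoc]
  rfl

lemma stronglyMeasurable_innovation (s : ℕ) :
    StronglyMeasurable[pastFiltration α (s + 1)] (innovation ν g s) := by
  have hcoord : Measurable[pastFiltration α (s + 1)] (coord (α := α) ((s : ℤ) + 1)) :=
    measurable_sigmaOf coord (by simp)
  exact ((measurable_of_finite g).comp hcoord).stronglyMeasurable.sub
    (stronglyMeasurable_condExp.mono ((pastFiltration α).mono s.le_succ))

variable [IsFiniteMeasure ν]

lemma condExp_innovation (s : ℕ) : ν[innovation ν g s | pastFiltration α s] =ᵐ[ν] 0 := by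
  have hint := integrable_comp_apply (ν := ν) g ((s : ℤ) + 1)
  refine (condExp_sub hint integrable_condExp _).trans ?_
  rw [condExp_of_stronglyMeasurable ((pastFiltration α).le s) stronglyMeasurable_condExp
    integrable_condExp, sub_self]

omit [Finite α] [MeasurableSingletonClass α] [IsFiniteMeasure ν] in
lemma ae_abs_innovation_le {C : ℝ} (hg : ∀ a, |g a| ≤ C) (s : ℕ) :
    ∀ᵐ x ∂ν, |innovation ν g s x| ≤ 2 * C := by
  have hcond : ∀ᵐ x ∂ν, |(ν[fun y => g (y ((s : ℤ) + 1)) | pastFiltration α s]) x| ≤ C :=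
    ae_bdd_abs_condExp_of_ae_bdd_abs (ae_of_all _ fun x => hg _)
  filter_upwards [hcond] with x hx
  exact (abs_sub _ _).trans (by linarith [hg (x ((s : ℤ) + 1))])

lemma ae_innovation_eq (hT : MeasurePreserving shift ν ν) : ∀ᵐ x ∂ν, ∀ s,
    innovation ν g s x = g (x ((s : ℤ) + 1)) - pastMean ν g (shift^[s] x) := by
  refine ae_all_iff.2 fun s => ?_
  filter_upwards [condExp_Iic_eq g hT s] with x hx
  exact congrArg (g (x ((s : ℤ) + 1)) - ·) hx

/-- The realizations for which the word `w` has at least `j` occurrences before time `n` and the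
innovations following them have average larger than `ε`. -/
def wordDeviationSet (ν : Measure (ℤ → α)) (g : α → ℝ) (ε : ℝ) (n : ℕ) (k : ℕ) (w : Fin k → α)
    (j : ℕ) : Set (ℤ → α) :=
  {x | (j : ℝ) ≤ ∑ s ∈ Finset.range n, (occurrenceSet k w s).indicator 1 x ∧
    ε * ∑ s ∈ Finset.range n, (occurrenceSet k w s).indicator 1 x <
      |∑ s ∈ Finset.range n, (occurrenceSet k w s).indicator (innovation ν g s) x|}

omit [IsFiniteMeasure ν] in
lemma exists_measureReal_wordDeviationSet_le [IsProbabilityMeasure ν] {ε : ℝ} (hε : 0 < ε) :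
    ∃ δ > 0, ∀ n k (w : Fin k → α) j,
      ν.real (wordDeviationSet ν g ε n k w j) ≤ 2 * Real.exp (-δ * j) := by
  obtain ⟨C, hC0, hC⟩ := exists_pos_forall_abs_le g
  set B := 2 * C 
  have hB0 : 0 < B := by positivity
  set θ : ℝ := min (1 / B) (ε / (2 * B ^ 2))
  have hθ0 : 0 < θ := lt_min (by positivity) (by positivity)
  have hθB : θ * B ≤ 1 := (le_div_iff₀ hB0).1 (min_le_left _ _)
  have hθε : θ * (2 * B ^ 2) ≤ ε := (le_div_iff₀ (by positivity)).1 (min_le_right _ _)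
  exact ⟨θ * ε / 2, by positivity, fun n k w j => measureReal_mul_lt_abs_sum_indicator_le
    (measurableSet_occurrenceSet k w) (stronglyMeasurable_innovation g) (condExp_innovation g)
    (ae_abs_innovation_le g hC) hθ0.le hθB (by linarith) n j⟩

end Occurrences

variable {α : Type*} [MeasurableSpace α] [Fintype α] [MeasurableSingletonClass α]

lemma measurableSet_scarceSet (n : ℕ) : MeasurableSet (scarceSet α n) := by
  simp only [scarceSet, ← Nat.cast_lt (α := ℝ)]
  exact measurableSet_lt (measurable_card_matchTimes _ _) measurable_const

lemma measurableSet_largeAverageSet {D : (ℤ → α) → ℝ} (hD : Measurable D) (ε : ℝ) (n : ℕ) :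
    MeasurableSet (largeAverageSet D ε n) :=
  measurableSet_lt ((measurable_card_matchTimes _ _).const_mul ε)
    (measurable_sum_matchTimes _ _ fun s => hD.comp (measurable_shift.iterate s))

variable {ν : Measure (ℤ → α)} [IsProbabilityMeasure ν]

section Deviations

/-- The realizations for which some word of length at most `K α n` has frequent earlier occurrences
at time `n`, but `g` of the letters following them is on average far from the conditional means. -/
def deviationSet (ν : Measure (ℤ → α)) (g : α → ℝ) (ε : ℝ) (n : ℕ) : Set (ℤ → α) :=
  {x | ∃ k ≤ K α n, J n ≤ #(matchTimes x k n) ∧ ε * #(matchTimes x k n) <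
    |∑ s ∈ matchTimes x k n, (g (x ((s : ℤ) + 1)) - pastMean ν g (shift^[s] x))|}

variable (hT : MeasurePreserving shift ν ν) (g : α → ℝ) {ε : ℝ}

include hT

lemma deviationSet_ae_le (ε : ℝ) (n : ℕ) : deviationSet ν g ε n ≤ᵐ[ν]
    (⋃ k ∈ Finset.range (K α n + 1), ⋃ w ∈ (Finset.univ : Finset (Fin k → α)),
      wordDeviationSet ν g ε n k w (J n) : Set (ℤ → α)) := by
  filter_upwards [ae_innovation_eq g hT] with x hx
  rintro ⟨k, hk, hJ, hdev⟩
  have hcard := sum_matchTimes_eq_sum_indicator x k n fun _ => 1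
  simp only [Pi.one_apply, Finset.sum_const, nsmul_eq_mul, mul_one] at hcard
  simp only [← hx, sum_matchTimes_eq_sum_indicator x k n (innovation ν g), hcard] at hdev
  refine Set.mem_biUnion (Finset.mem_range_succ_iff.2 hk)
    (Set.mem_biUnion (Finset.mem_univ (word x k n)) ⟨?_, hdev⟩)
  rw [← hcard]
  exact_mod_cast hJ

variable [Nonempty α] (hε : 0 < ε)

include hε

lemma summable_measureReal_deviationSet : Summable fun n => ν.real (deviationSet ν g ε n) := by
  obtain ⟨δ, hδ, hword⟩ := exists_measureReal_wordDeviationSet_le (ν := ν) g hε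
  refine .of_nonneg_of_le (fun n => measureReal_nonneg) (fun n => ?_)
    ((summable_words_mul_exp α hδ).mul_left 2)
  calc ν.real (deviationSet ν g ε n)
      ≤ ν.real (⋃ k ∈ Finset.range (K α n + 1), ⋃ w ∈ (Finset.univ : Finset (Fin k → α)),
          wordDeviationSet ν g ε n k w (J n)) :=
        ENNReal.toReal_mono (measure_ne_top _ _) (measure_mono_ae (deviationSet_ae_le hT g ε n))
    _ ≤ ∑ k ∈ Finset.range (K α n + 1), ∑ w : Fin k → α,
          ν.real (wordDeviationSet ν g ε n k w (J n)) :=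
        (measureReal_biUnion_finset_le _ _).trans
          (Finset.sum_le_sum fun k _ => measureReal_biUnion_finset_le _ _)
    _ ≤ ∑ k ∈ Finset.range (K α n + 1),
          (Fintype.card α : ℝ) ^ K α n * (2 * Real.exp (-δ * J n)) := by
        gcongr with k hk
        refine (Finset.sum_le_sum fun w _ => hword n k w (J n)).trans ?_
        rw [Finset.sum_const, nsmul_eq_mul, Finset.card_univ]
        gcongr
        exact_mod_cast card_words_le (Finset.mem_range_succ_iff.1 hk)
    _ = 2 * (((K α n + 1) * (Fintype.card α : ℝ) ^ K α n : ℝ) * Real.exp (-δ * J n)) := by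
        rw [Finset.sum_const, Finset.card_range, nsmul_eq_mul]
        push_cast
        ring

lemma ae_eventually_notMem_deviationSet : ∀ᵐ x ∂ν, ∀ᶠ n in atTop, x ∉ deviationSet ν g ε n := by
  have hsum := (summable_measureReal_deviationSet hT g hε).tsum_ofReal_ne_top
  simp_rw [ofReal_measureReal (measure_ne_top ν _)] at hsum
  exact ae_eventually_notMem hsum

end Deviations

variable (hT : MeasurePreserving shift ν ν)

include hT

lemma measureReal_scarceSet_le [Nonempty α] (n : ℕ) :
    n * ν.real (scarceSet α n) ≤ (Fintype.card α ^ K α n * J n + K α n : ℕ) := by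
  have hmax := mul_measureReal_le_integral (c := 1) (n := n) hT (measurableSet_scarceSet n)
    (integrable_const ((Fintype.card α ^ K α n * J n + K α n : ℕ) : ℝ)) fun x => by
      rw [one_mul]
      exact_mod_cast card_scarce_shift_le x n
  simpa only [one_mul, integral_const, probReal_univ, one_smul] using hmax

lemma measureReal_largeAverageSet_le {D : (ℤ → α) → ℝ} (hD : Measurable D) (hD0 : ∀ x, 0 ≤ D x)
    (hDi : Integrable D ν) {ε : ℝ} (hε : 0 < ε) {n : ℕ} (hn : 1 ≤ n) :
    ν.real (largeAverageSet D ε n) ≤ 2 * (∫ x, D x ∂ν) / ε := by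
  have hn0 : (0 : ℝ) < n := by exact_mod_cast hn
  have hmax := mul_measureReal_le_integral hT (measurableSet_largeAverageSet hD ε n)
    (integrable_finsetSum _ fun s _ => (hT.iterate s).integrable_comp_of_integrable hDi)
    fun x => mul_card_largeAverage_shift_le x hD0 hε.le n
  have hsum : ∫ x, ∑ s ∈ Finset.range (2 * n), D (shift^[s] x) ∂ν = (2 * n : ℕ) * ∫ x, D x ∂ν :=
    integral_birkhoffSum hT hDi (2 * n)
  simp only [Function.comp_apply, hsum, Nat.cast_mul, Nat.cast_ofNat] at hmax
  rw [le_div_iff₀ hε]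
  exact le_of_mul_le_mul_left (by linarith) hn0

end Probability

section ErrorControl

lemma abs_average_sub_le {ι : Type*} {S : Finset ι} (hS : S.Nonempty) {a b : ι → ℝ} {c ε δ : ℝ}
    (hab : |∑ i ∈ S, (a i - b i)| ≤ ε * #S) (hbc : ∑ i ∈ S, |b i - c| ≤ δ * #S) :
    |1 / (#S : ℝ) * ∑ i ∈ S, a i - c| ≤ ε + δ := by
  have hS0 : (0 : ℝ) < #S := by exact_mod_cast hS.card_pos
  have hsplit : 1 / (#S : ℝ) * ∑ i ∈ S, a i - c =
      (∑ i ∈ S, (a i - b i) + ∑ i ∈ S, (b i - c)) / #S := by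
    rw [← Finset.sum_add_distrib]
    simp only [sub_add_sub_cancel, Finset.sum_sub_distrib, Finset.sum_const, nsmul_eq_mul]
    field_simp
  rw [hsplit, abs_div, abs_of_pos hS0, div_le_iff₀ hS0, add_mul]
  exact (abs_add_le _ _).trans
    (add_le_add hab ((Finset.abs_sum_le_sum_abs _ _).trans hbc))

variable {α : Type*} [MeasurableSpace α] [Fintype α] {ν : Measure (ℤ → α)} {g : α → ℝ}
  {ε : ℝ} {k n : ℕ} {x : ℤ → α}

lemma abs_estimator_sub_le {c δ : ℝ} (hκ : 0 < kappa x n) (hdev : x ∉ deviationSet ν g ε n)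
    (hc : ∑ s ∈ matchTimes x (kappa x n) n, |pastMean ν g (shift^[s] x) - c| ≤
      δ * #(matchTimes x (kappa x n) n)) : |estimator g x n - c| ≤ ε + δ := by
  obtain ⟨hκK, hJ⟩ := kappa_mem hκ
  rw [estimator_eq g hκ]
  refine abs_average_sub_le (Finset.card_pos.1 ((one_le_J n).trans hJ)) ?_ hc
  by_contra! hlt
  exact hdev ⟨_, hκK, hJ, hlt⟩

lemma predictionError_le
    (hword : ∀ a b : ℤ, word x (K α n) a = word x (K α n) b → word x (k + 1) a = word x (k + 1) b)
    (hscarce : x ∉ scarceSet α n) (hdev : x ∉ deviationSet ν g ε n)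
    (hlarge : x ∉ largeAverageSet (meanGap ν g k) ε n) :
    predictionError ν g n x ≤
      2 * ε + (meanGap ν g k (shift^[n] x) + meanGap ν g n (shift^[n] x)) := by
  have hκ : kappa x n = K α n := kappa_eq_K (not_lt.1 hscarce)
  have hconst : ∀ s ∈ matchTimes x (kappa x n) n,
      recentMean ν g k (shift^[n] x) = recentMean ν g k (shift^[s] x) := by
    intro s hs
    refine recentMean_eq_of_word_eq g ?_
    rw [word_shift_iterate, word_shift_iterate, zero_add, zero_add]
    exact (hword _ _ (by rw [← hκ]; exact (mem_matchTimes.1 hs).2)).symm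
  have hest : |estimator g x n - recentMean ν g k (shift^[n] x)| ≤ ε + ε := by
    refine abs_estimator_sub_le (hκ ▸ one_le_K α n) hdev ?_
    rw [Finset.sum_congr rfl fun s hs => by rw [hconst s hs], hκ]
    exact not_lt.1 hlarge
  calc predictionError ν g n x
      ≤ |estimator g x n - recentMean ν g k (shift^[n] x)| +
          |recentMean ν g k (shift^[n] x) - recentMean ν g n (shift^[n] x)| := abs_sub_le _ _ _
    _ ≤ (ε + ε) + (|recentMean ν g k (shift^[n] x) - pastMean ν g (shift^[n] x)| +
          meanGap ν g n (shift^[n] x)) := add_le_add hest (abs_sub_le _ _ _)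
    _ = _ := by rw [abs_sub_comm, ← two_mul]; rfl

lemma predictionError_le_add_indicator {C : ℝ} (hε : 0 ≤ ε) (hC : 0 ≤ C)
    (hword : ∀ a b : ℤ, word x (K α n) a = word x (K α n) b → word x (k + 1) a = word x (k + 1) b)
    (hbound : predictionError ν g n x ≤ C) (hdev : x ∉ deviationSet ν g ε n) :
    predictionError ν g n x ≤
      2 * ε + (meanGap ν g k (shift^[n] x) + meanGap ν g n (shift^[n] x)) +
        C * ((scarceSet α n).indicator 1 x +
          (largeAverageSet (meanGap ν g k) ε n).indicator 1 x) := by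
  have hgap := add_nonneg (meanGap_nonneg (ν := ν) g k (shift^[n] x))
    (meanGap_nonneg (ν := ν) g n (shift^[n] x))
  have hind : 0 ≤ (largeAverageSet (meanGap ν g k) ε n).indicator (1 : (ℤ → α) → ℝ) x :=
    Set.indicator_nonneg (fun _ _ => zero_le_one) x
  by_cases hscarce : x ∈ scarceSet α n
  · rw [Set.indicator_of_mem hscarce, Pi.one_apply]
    linarith [mul_nonneg hC hind]
  by_cases hlarge : x ∈ largeAverageSet (meanGap ν g k) ε n
  · rw [Set.indicator_of_notMem hscarce, Set.indicator_of_mem hlarge, Pi.one_apply]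
    linarith
  · rw [Set.indicator_of_notMem hscarce, Set.indicator_of_notMem hlarge]
    linarith [predictionError_le hword hscarce hdev hlarge]

lemma eventually_word_eq_of_word_K_eq (α : Type*) [Fintype α] (k : ℕ) :
    ∀ᶠ n in atTop, ∀ (x : ℤ → α) (a b : ℤ),
      word x (K α n) a = word x (K α n) b → word x k a = word x k b := by
  filter_upwards [eventually_word_eq_of_min_le α k] with n hn x a b
  exact hn x a b _ (min_le_right _ _)

variable [MeasurableSingletonClass α] [IsProbabilityMeasure ν] [Nonempty α]

section Probability

variable (hT : MeasurePreserving shift ν ν)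

include hT

lemma tendsto_measureReal_scarceSet :
    Tendsto (fun n => ν.real (scarceSet α n)) atTop (𝓝 0) := by
  refine squeeze_zero' (.of_forall fun n => measureReal_nonneg) ?_ (tendsto_words_mul_J_div α)
  filter_upwards [eventually_ge_atTop 1] with n hn
  rw [le_div_iff₀' (by exact_mod_cast hn)]
  exact (measureReal_scarceSet_le hT n).trans
    (by exact_mod_cast Nat.le_mul_of_pos_left _ (K α n).succ_pos)

omit [Fintype α] [MeasurableSingletonClass α] [Nonempty α] in
lemma measureReal_lt_meanGap_le (g : α → ℝ) (hε : 0 < ε) (k n : ℕ) :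
    ν.real {x | ε < meanGap ν g k (shift^[n] x)} ≤ (∫ x, meanGap ν g k x ∂ν) / ε := by
  have hpre : ν.real {x | ε < meanGap ν g k (shift^[n] x)} = ν.real {x | ε < meanGap ν g k x} :=
    (hT.iterate n).measureReal_preimage
      (measurableSet_lt measurable_const (measurable_meanGap g k)).nullMeasurableSet
  rw [hpre, le_div_iff₀' hε]
  refine le_trans ?_ (mul_meas_ge_le_integral_of_nonneg
    (.of_forall (meanGap_nonneg g k)) (integrable_meanGap g k) ε)
  exact mul_le_mul_of_nonneg_left
    (measureReal_mono (Set.ofPred_subset_ofPred.2 fun x hx => hx.le) (measure_ne_top ν _)) hε.le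

omit [Nonempty α] in
lemma measureReal_lt_predictionError_le (hε : 0 < ε) (hn : 1 ≤ n)
    (hword : ∀ (x : ℤ → α) (a b : ℤ),
      word x (K α n) a = word x (K α n) b → word x (k + 1) a = word x (k + 1) b) :
    ν.real {x | 4 * ε < predictionError ν g n x} ≤
      ν.real (scarceSet α n) + (ν.real (deviationSet ν g ε n) +
        (2 * (∫ x, meanGap ν g k x ∂ν) / ε +
          ((∫ x, meanGap ν g k x ∂ν) / ε + (∫ x, meanGap ν g n x ∂ν) / ε))) := by
  have hsub : {x | 4 * ε < predictionError ν g n x} ⊆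
      scarceSet α n ∪ (deviationSet ν g ε n ∪ (largeAverageSet (meanGap ν g k) ε n ∪
        ({x | ε < meanGap ν g k (shift^[n] x)} ∪ {x | ε < meanGap ν g n (shift^[n] x)}))) := by
    intro x (hx : 4 * ε < predictionError ν g n x)
    by_contra hnot
    simp only [Set.mem_union, not_or, Set.mem_ofPred_eq, not_lt] at hnot
    obtain ⟨hscarce, hdev, hlarge, hgapk, hgapn⟩ := hnot
    linarith [predictionError_le (hword x) hscarce hdev hlarge]
  refine (measureReal_mono hsub).trans ((measureReal_union_le _ _).trans ?_)
  gcongr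
  refine (measureReal_union_le _ _).trans ?_
  gcongr
  refine (measureReal_union_le _ _).trans (add_le_add ?_ ((measureReal_union_le _ _).trans ?_))
  · exact measureReal_largeAverageSet_le hT (measurable_meanGap g k) (meanGap_nonneg g k)
      (integrable_meanGap g k) hε hn
  · exact add_le_add (measureReal_lt_meanGap_le hT g hε k n) (measureReal_lt_meanGap_le hT g hε n n)

theorem tendsto_measureReal_predictionError (g : α → ℝ) (hε : 0 < ε) :
    Tendsto (fun n => ν.real {x | ε < predictionError ν g n x}) atTop (𝓝 0) := by
  set ε' := ε / 4
  have hε4 : ε = 4 * ε' := by ring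
  have hpos : 0 < ε' := by positivity
  set d : ℕ → ℝ := fun k => ∫ x, meanGap ν g k x ∂ν
  have hd : Tendsto d atTop (𝓝 0) := tendsto_integral_meanGap g
  rw [hε4]
  refine tendsto_order.2 ⟨fun ρ hρ => .of_forall fun n => hρ.trans_le measureReal_nonneg,
    fun ρ hρ => ?_⟩
  have hdlim : Tendsto (fun k => 2 * d k / ε' + (d k / ε' + 0)) atTop (𝓝 0) := by
    simpa using ((hd.const_mul 2).div_const ε').add (hd.div_const ε')
  obtain ⟨k, hk⟩ := (hdlim.eventually (gt_mem_nhds hρ)).exists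
  have hlim : Tendsto (fun n => ν.real (scarceSet α n) + (ν.real (deviationSet ν g ε' n) +
      (2 * d k / ε' + (d k / ε' + d n / ε')))) atTop
      (𝓝 (0 + (0 + (2 * d k / ε' + (d k / ε' + 0 / ε'))))) :=
    (tendsto_measureReal_scarceSet hT).add
      ((summable_measureReal_deviationSet hT g hpos).tendsto_atTop_zero.add
        ((hd.div_const ε').const_add _ |>.const_add _))
  filter_upwards [hlim.eventually (gt_mem_nhds (by simpa using hk)),
    eventually_word_eq_of_word_K_eq α (k + 1), eventually_ge_atTop 1] with n hn hword hn1
  exact (measureReal_lt_predictionError_le hT hpos hn1 hword).trans_lt hn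

end Probability

section Average

variable (hT : Ergodic shift ν)

include hT

lemma ae_avgLE_predictionError_of_bound {C : ℝ} (hC : 0 < C) (hg : ∀ a, |g a| ≤ C) (hε : 0 < ε)
    {L : ℕ} (hL : ∀ N m : ℕ, ε * N ≤ m → K α N ≤ K α m + L) (k : ℕ) :
    ∀ᵐ x ∂ν, AvgLE (fun m => predictionError ν g m x)
      (2 * ε + ((∫ x, meanGap ν g k x ∂ν) + 0) +
        2 * C * (0 + (ε + (L + 1) / ε * ∫ x, meanGap ν g k x ∂ν))) := by
  filter_upwards [ae_all_iterate hT.toMeasurePreserving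
      (ae_all_iff.2 fun m => ae_abs_recentMean_le (ν := ν) hg m),
    ae_avgLE hT (measurable_meanGap g k) (integrable_meanGap g k),
    ae_avgLE_diagonal hT (measurable_meanGap g) (ae_meanGap_le hg) (ae_tendsto_meanGap g),
    ae_eventually_notMem_deviationSet hT.toMeasurePreserving g hε] with x hrecent hk hdiag hdev
  have hlarge := avgLE_indicator_largeAverageSet (meanGap_nonneg (ν := ν) g k) hε hε hL hk
  refine (((avgLE_const (2 * ε)).add (hk.add hdiag)).add
    (((avgLE_indicator_scarceSet x).add hlarge).const_mul
      (c := 2 * C) (by positivity))).of_eventually_le ?_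
  filter_upwards [hdev, eventually_word_eq_of_word_K_eq α (k + 1)] with m hdev hword
  refine predictionError_le_add_indicator hε.le (by positivity) (hword x) ?_ hdev
  exact (abs_sub _ _).trans (by linarith [abs_estimator_le hg x m, hrecent m m])

theorem ae_avgLE_predictionError (g : α → ℝ) :
    ∀ᵐ x ∂ν, AvgLE (fun m => predictionError ν g m x) 0 := by
  obtain ⟨C, hC0, hC⟩ := exists_pos_forall_abs_le g
  refine (ae_forall_gt (p := fun q x => AvgLE (fun m => predictionError ν g m x) q)
    (fun x q r hqr h => h.mono hqr) fun q hq => ?_).mono fun x hx => AvgLE.of_forall_gt hx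
  obtain ⟨ε, hε, hεq⟩ : ∃ ε > 0, (2 + 2 * C) * ε < q :=
    ⟨q / (2 * (2 + 2 * C)), by positivity, by field_simp; linarith⟩
  obtain ⟨L, hL⟩ := exists_K_le_add α hε
  have hlim : Tendsto (fun k => 2 * ε + ((∫ x, meanGap ν g k x ∂ν) + 0) +
      2 * C * (0 + (ε + (L + 1) / ε * ∫ x, meanGap ν g k x ∂ν))) atTop
      (𝓝 (2 * ε + (0 + 0) + 2 * C * (0 + (ε + (L + 1) / ε * 0)))) := by
    have hd := tendsto_integral_meanGap (ν := ν) g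
    exact ((hd.add_const 0).const_add _).add
      ((((hd.const_mul _).const_add ε).const_add 0).const_mul _)
  obtain ⟨k, hk⟩ := (hlim.eventually (gt_mem_nhds (by linarith : _ < q))).exists
  filter_upwards [ae_avgLE_predictionError_of_bound hT hC0 hC hε hL k] with x hx
  exact hx.mono hk.le

end Average

end ErrorControl

section Continuity

variable {α : Type*}

lemma dStar_le_of_agree {x y : ℕ → α} {k : ℕ} (h : ∀ i < k, x i = y i) :
    dStar x y ≤ (2 : ℝ)⁻¹ ^ k := by
  classical
  have hgeom : HasSum (fun i : ℕ => (2 : ℝ)⁻¹ ^ (i + k + 1)) (2⁻¹ ^ k) := by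
    have hsum := (hasSum_geometric_of_lt_one (r := (2 : ℝ)⁻¹) (by norm_num) (by norm_num)).mul_left
      (2⁻¹ ^ (k + 1))
    rw [show (2 : ℝ)⁻¹ ^ (k + 1) * (1 - 2⁻¹)⁻¹ = 2⁻¹ ^ k by rw [pow_succ]; ring] at hsum
    exact hsum.congr_fun fun i => by ring
  have hle (i : ℕ) : (2 : ℝ)⁻¹ ^ (i + k + 1) * (if x (i + k) ≠ y (i + k) then 1 else 0) ≤
      2⁻¹ ^ (i + k + 1) := mul_le_of_le_one_right (by positivity) (by split_ifs <;> norm_num)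
  have htail : Summable fun i : ℕ =>
      (2 : ℝ)⁻¹ ^ (i + k + 1) * (if x (i + k) ≠ y (i + k) then 1 else 0) :=
    .of_nonneg_of_le (fun i => by positivity) hle hgeom.summable
  have hall : Summable fun i : ℕ => (2 : ℝ)⁻¹ ^ (i + 1) * (if x i ≠ y i then 1 else 0) :=
    (summable_nat_add_iff k).1 htail
  have hhead : ∑ i ∈ Finset.range k, (2 : ℝ)⁻¹ ^ (i + 1) * (if x i ≠ y i then 1 else 0) = 0 :=
    Finset.sum_eq_zero fun i hi => by simp [h i (Finset.mem_range.1 hi)]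
  rw [dStar, ← hall.sum_add_tsum_nat_add k, hhead, zero_add, ← hgeom.tsum_eq]
  exact htail.tsum_le_tsum hle hgeom.summable

/-- Continuity with respect to `dStar`, in the form in which it enters `HasContinuousVersion`. -/
def DStarContinuous (G : (ℕ → α) → ℝ) : Prop :=
  ∀ x, ∀ ε > 0, ∃ δ > 0, ∀ y, dStar x y < δ → |G y - G x| < ε

namespace DStarContinuous

variable {G : (ℕ → α) → ℝ}

lemma exists_cylinder (hG : DStarContinuous G) (x : ℕ → α) {ε : ℝ} (hε : 0 < ε) :
    ∃ k, ∀ y ∈ PiNat.cylinder x k, |G y - G x| < ε := by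
  obtain ⟨δ, hδ, h⟩ := hG x ε hε
  obtain ⟨k, hk⟩ := exists_pow_lt_of_lt_one hδ (by norm_num : (2 : ℝ)⁻¹ < 1)
  exact ⟨k, fun y hy => h y ((dStar_le_of_agree fun i hi => (hy i hi).symm).trans_lt hk)⟩

lemma continuous [TopologicalSpace α] [DiscreteTopology α] (hG : DStarContinuous G) :
    Continuous G := by
  refine continuous_iff_continuousAt.2 fun x => Metric.tendsto_nhds.2 fun ε hε => ?_
  obtain ⟨k, hk⟩ := hG.exists_cylinder x hε
  exact eventually_of_mem
    ((PiNat.isOpen_cylinder _ x k).mem_nhds (PiNat.self_mem_cylinder x k)) hk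

lemma exists_uniform_cylinder [Finite α] (hG : DStarContinuous G) {ε : ℝ} (hε : 0 < ε) :
    ∃ k, ∀ x, ∀ y ∈ PiNat.cylinder x k, |G y - G x| ≤ ε := by
  let _ : TopologicalSpace α := ⊥
  have : DiscreteTopology α := ⟨rfl⟩
  choose k hk using fun x => hG.exists_cylinder x (half_pos hε)
  obtain ⟨t, -, ht⟩ := (isCompact_univ (X := ℕ → α)).elim_nhds_subcover
    (fun x => PiNat.cylinder x (k x))
    (fun x _ => (PiNat.isOpen_cylinder _ x _).mem_nhds (PiNat.self_mem_cylinder x _))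
  refine ⟨t.sup k, fun x y hy => ?_⟩
  obtain ⟨z, hz, hxz⟩ := Set.mem_iUnion₂.1 (ht (Set.mem_univ x))
  have hyz : y ∈ PiNat.cylinder z (k z) := by
    rw [← PiNat.mem_cylinder_iff_eq.1 hxz]
    exact PiNat.cylinder_anti x (Finset.le_sup hz) hy
  have hdist := abs_sub_le (G y) (G z) (G x)
  rw [abs_sub_comm (G z)] at hdist
  linarith [hk z x hxz, hk z y hyz]

lemma measurable [Finite α] [MeasurableSpace α] [MeasurableSingletonClass α]
    (hG : DStarContinuous G) : Measurable G := by
  let _ : TopologicalSpace α := ⊥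
  have : DiscreteTopology α := ⟨rfl⟩
  exact hG.continuous.measurable

end DStarContinuous

/-- The one-sided past `(…, x_{-1}, x_0)`, indexed as in `dStar`. -/
def pastOf (x : ℤ → α) (i : ℕ) : α := x (-(i : ℤ))

lemma pastOf_mem_cylinder {x : ℤ → α} {k a b : ℕ} (h : word x k a = word x k b) :
    pastOf (shift^[a] x) ∈ PiNat.cylinder (pastOf (shift^[b] x)) k := by
  intro i hi
  simpa only [pastOf, shift_iterate_apply, word, neg_add_eq_sub] using congrFun h ⟨i, hi⟩

variable [MeasurableSpace α]

lemma measurable_pastOf : Measurable (pastOf (α := α)) :=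
  measurable_pi_lambda _ fun i => measurable_pi_apply (-(i : ℤ))

variable {ν : Measure (ℤ → α)} [IsProbabilityMeasure ν]

lemma ae_meanGap_le_of_cylinder {g : α → ℝ} {G : (ℕ → α) → ℝ} {ε : ℝ} {k n : ℕ}
    (hGm : Measurable G) (hG : (fun x => G (pastOf x)) =ᵐ[ν] pastMean ν g)
    (hk : ∀ x, ∀ y ∈ PiNat.cylinder x k, |G y - G x| ≤ ε) (hkn : k ≤ n) :
    ∀ᵐ x ∂ν, meanGap ν g n x ≤ 2 * ε := by
  -- Freezing the letters beyond time `-n` makes `G (pastOf x)` measurable for the finite window.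
  let frozen : (ℤ → α) → ℕ → α := fun x i => x (-(min i n : ℕ))
  have hfrozen : StronglyMeasurable[sigmaOf coord (Set.Icc (-(n : ℤ)) 0)]
      fun x : ℤ → α => G (frozen x) := by
    refine (hGm.comp
      (@measurable_pi_lambda _ _ _ (sigmaOf coord _) _ _ fun i => ?_)).stronglyMeasurable
    exact measurable_sigmaOf coord (i := -((min i n : ℕ) : ℤ)) ⟨by omega, by omega⟩
  have hclose : ∀ᵐ x ∂ν, |pastMean ν g x - G (frozen x)| ≤ ε := by
    filter_upwards [hG] with x hx
    rw [← hx]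
    refine hk _ _ fun i hi => ?_
    simp only [pastOf, frozen, min_eq_left (hi.le.trans hkn)]
  have htower : ν[pastMean ν g | sigmaOf coord (Set.Icc (-(n : ℤ)) 0)] =ᵐ[ν] recentMean ν g n :=
    condExp_condExp_of_le (sigmaOf_mono coord fun i hi => hi.2) (sigmaOf_coord_le _)
  filter_upwards [htower, ae_abs_sub_condExp_le (sigmaOf_coord_le _) integrable_condExp hfrozen
    hclose] with x htower hx
  change |_ - (ν[pastMean ν g | sigmaOf coord (Set.Icc (-(n : ℤ)) 0)]) x| ≤ 2 * ε at hx
  rwa [htower] at hx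

end Continuity

section Recurrence

variable {α : Type*}

lemma sum_indicator_word_le {x : ℤ → α} {k n : ℕ} {w : Fin k → α} (hw : word x k n = w) :
    ∑ s ∈ Finset.range n, {y : ℤ → α | word y k 0 = w}.indicator 1 (shift^[s] x) ≤
      (#(matchTimes x k n) : ℝ) + k := by
  classical
  have hcount : ∑ s ∈ Finset.range n, {y : ℤ → α | word y k 0 = w}.indicator 1 (shift^[s] x) =
      (#{s ∈ Finset.range n | word x k (s : ℕ) = w} : ℝ) := by
    rw [Finset.card_filter, Nat.cast_sum]
    refine Finset.sum_congr rfl fun s _ => ?_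
    simp [Set.indicator_apply, word_shift_iterate]
  have hsub : {s ∈ Finset.range n | word x k (s : ℕ) = w} ⊆
      matchTimes x k n ∪ Finset.range k := by
    intro s hs
    simp only [Finset.mem_union, Finset.mem_filter, Finset.mem_range, mem_matchTimes, hw] at hs ⊢
    by_cases hks : k ≤ s + 1
    · exact .inl ⟨⟨hks, hs.1⟩, hs.2⟩
    · exact .inr (by omega)
  rw [hcount]
  exact_mod_cast (Finset.card_le_card hsub).trans
    ((Finset.card_union_le _ _).trans_eq (by rw [Finset.card_range]))

variable [MeasurableSpace α] [MeasurableSingletonClass α]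
  {ν : Measure (ℤ → α)} [IsProbabilityMeasure ν]

lemma ae_eventually_le_card_matchTimes_of_word_eq (hT : Ergodic shift ν) {k : ℕ} (w : Fin k → α) :
    ∀ᵐ x ∂ν, ∀ᶠ n : ℕ in atTop, word x k n = w → J n ≤ #(matchTimes x k n) := by
  set A : Set (ℤ → α) := {y | word y k 0 = w} with hA
  have hmem (x : ℤ → α) (n : ℕ) : shift^[n] x ∈ A ↔ word x k n = w := by
    simp [hA, word_shift_iterate]
  have hAm : MeasurableSet A :=
    (measurable_word k 0).mono (sigmaOf_coord_le _) le_rfl (measurableSet_singleton w)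
  obtain hzero | hpos := (measureReal_nonneg (μ := ν) (s := A)).eq_or_lt
  · have hnever : ∀ᵐ x ∂ν, x ∉ A :=
      measure_eq_zero_iff_ae_notMem.1 ((measureReal_eq_zero_iff).1 hzero.symm)
    filter_upwards [ae_all_iterate hT.toMeasurePreserving hnever] with x hx
    exact .of_forall fun n hn => absurd ((hmem x n).2 hn) (hx n)
  · obtain ⟨q, hq, hqA⟩ := exists_between hpos
    have hlim : Tendsto (fun n : ℕ => (J n : ℝ) / n + k / n) atTop (𝓝 0) := by
      simpa using tendsto_J_div.add (tendsto_const_div_atTop_nhds_zero_nat (k : ℝ))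
    filter_upwards [ae_eventually_mul_le_card_visits hT hAm hqA] with x hx
    filter_upwards [hx, hlim.eventually (gt_mem_nhds hq), eventually_gt_atTop 0]
      with n hvisits hlt hn hw
    rw [← add_div, div_lt_iff₀ (by exact_mod_cast hn)] at hlt
    have hcount := sum_indicator_word_le hw
    exact_mod_cast (by linarith : (J n : ℝ) ≤ #(matchTimes x k n))

lemma ae_eventually_le_card_matchTimes [Finite α] (hT : Ergodic shift ν) (k : ℕ) :
    ∀ᵐ x ∂ν, ∀ᶠ n in atTop, J n ≤ #(matchTimes x k n) := by
  filter_upwards [ae_all_iff.2 fun w =>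
    ae_eventually_le_card_matchTimes_of_word_eq (k := k) hT w] with x hx
  filter_upwards [eventually_all.2 hx] with n hn
  exact hn _ rfl

lemma ae_eventually_min_le_kappa [Fintype α] (hT : Ergodic shift ν) {k : ℕ} (hk : 1 ≤ k) :
    ∀ᵐ x ∂ν, ∀ᶠ n in atTop, min k (K α n) ≤ kappa x n := by
  filter_upwards [ae_all_iff.2 fun l => ae_eventually_le_card_matchTimes hT l] with x hx
  filter_upwards [(Finset.range (k + 1)).eventually_all.2 fun l _ => hx l] with n hn
  exact le_kappa (le_min hk (one_le_K α n)) (min_le_right _ _)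
    (hn _ (Finset.mem_range.2 (Nat.lt_succ_of_le (min_le_left _ _))))

end Recurrence

section ContinuousCase

variable {α : Type*} [MeasurableSpace α] [Fintype α] [MeasurableSingletonClass α]
  {ν : Measure (ℤ → α)} [IsProbabilityMeasure ν] [Nonempty α] {g : α → ℝ} {G : (ℕ → α) → ℝ}

lemma ae_eventually_predictionError_le (hT : Ergodic shift ν)
    (hG : (fun x => G (pastOf x)) =ᵐ[ν] pastMean ν g) (hGc : DStarContinuous G)
    {ε : ℝ} (hε : 0 < ε) : ∀ᵐ x ∂ν, ∀ᶠ n in atTop, predictionError ν g n x ≤ 4 * ε := by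
  obtain ⟨k, hk⟩ := hGc.exists_uniform_cylinder hε
  have hgap : ∀ᵐ x ∂ν, ∀ n ≥ k, meanGap ν g n x ≤ 2 * ε :=
    ae_all_iff.2 fun n =>
      eventually_imp_distrib_left.2 (ae_meanGap_le_of_cylinder hGc.measurable hG hk)
  filter_upwards [ae_all_iterate hT.toMeasurePreserving hgap,
    ae_all_iterate hT.toMeasurePreserving hG, ae_eventually_min_le_kappa hT k.succ_pos,
    ae_eventually_notMem_deviationSet hT.toMeasurePreserving g hε] with x hgap hG hκ hdev
  filter_upwards [hκ, hdev, eventually_word_eq_of_min_le α k, eventually_ge_atTop k]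
    with n hκ hdev hword hkn
  have hκ1 : min 1 (K α n) ≤ kappa x n := (min_le_min_right _ k.succ_pos).trans hκ
  have hκk : min k (K α n) ≤ kappa x n := (min_le_min_right _ k.le_succ).trans hκ
  have hest : |estimator g x n - pastMean ν g (shift^[n] x)| ≤ ε + ε := by
    refine abs_estimator_sub_le (by rwa [min_eq_left (one_le_K α n)] at hκ1) hdev ?_
    rw [mul_comm, ← nsmul_eq_mul]
    refine Finset.sum_le_card_nsmul _ _ _ fun s hs => ?_
    rw [← hG s, ← hG n]
    exact hk _ _ (pastOf_mem_cylinder (hword x _ _ _ hκk (mem_matchTimes.1 hs).2))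
  have hgapn : |pastMean ν g (shift^[n] x) - recentMean ν g n (shift^[n] x)| ≤ 2 * ε :=
    hgap n n hkn
  have htriangle := abs_sub_le (estimator g x n) (pastMean ν g (shift^[n] x))
    (recentMean ν g n (shift^[n] x))
  rw [predictionError]
  linarith

theorem ae_tendsto_predictionError (hT : Ergodic shift ν)
    (hG : (fun x => G (pastOf x)) =ᵐ[ν] pastMean ν g) (hGc : DStarContinuous G) :
    ∀ᵐ x ∂ν, Tendsto (fun n => predictionError ν g n x) atTop (𝓝 0) := by
  have hle : ∀ᵐ x ∂ν, ∀ q > 0, ∀ᶠ n in atTop, predictionError ν g n x ≤ q := by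
    refine ae_forall_gt (p := fun q x => ∀ᶠ n in atTop, predictionError ν g n x ≤ q)
      (fun x q r hqr h => h.mono fun n hn => hn.trans hqr) fun q hq => ?_
    filter_upwards [ae_eventually_predictionError_le hT hG hGc (ε := q / 4) (by positivity)]
      with x hx
    simpa only [mul_div_cancel₀ q (four_ne_zero' ℝ)] using hx
  filter_upwards [hle] with x hx
  refine tendsto_order.2 ⟨fun q hq => .of_forall fun n => hq.trans_le
    (predictionError_nonneg g n x), fun q hq => ?_⟩
  exact (hx (q / 2) (half_pos hq)).mono fun n hn => hn.trans_lt (half_lt_self hq)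

end ContinuousCase

section Transfer

variable {Ω α : Type*} [MeasurableSpace Ω] [MeasurableSpace α] {μ : Measure Ω} {X : ℤ → Ω → α}

namespace IsStationaryErgodic

lemma measurable_path (hX : IsStationaryErgodic μ X) : Measurable (path X) :=
  measurable_pi_lambda _ hX.1

variable [MeasurableSingletonClass α] [IsProbabilityMeasure μ]

lemma condExp_eq_comp_path [Finite α] (hX : IsStationaryErgodic μ X) (g : α → ℝ)
    (s : Set ℤ) (i : ℤ) :
    μ[fun ω => g (X i ω) | sigmaOf X s] =ᵐ[μ]
      fun ω => ((μ.map (path X))[fun x => g (x i) | sigmaOf coord s]) (path X ω) := by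
  have := Measure.isProbabilityMeasure_map (μ := μ) hX.measurable_path.aemeasurable
  rw [← comap_path_sigmaOf X s]
  exact condExp_comp_comap hX.measurable_path (sigmaOf_coord_le s) (integrable_comp_apply g i)

lemma ae_error_eq [Fintype α] (hX : IsStationaryErgodic μ X) (g : α → ℝ) :
    ∀ᵐ ω ∂μ, ∀ n, error μ X g n ω = predictionError (μ.map (path X)) g n (path X ω) := by
  have := Measure.isProbabilityMeasure_map (μ := μ) hX.measurable_path.aemeasurable
  filter_upwards [ae_of_ae_map hX.measurable_path.aemeasurable
      (Forecast.ae_error_eq g hX.2.toMeasurePreserving),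
    ae_all_iff.2 fun n : ℕ => hX.condExp_eq_comp_path g (Set.Icc 0 (n : ℤ)) (n + 1)]
    with ω herror hcond n
  rw [← herror n, error, hcond n]
  rfl

lemma ae_pastOf_eq_pastMean [Finite α] (hX : IsStationaryErgodic μ X) {g : α → ℝ} {G : (ℕ → α) → ℝ}
    (hGm : Measurable G) (hG : (fun ω => G fun i => X (-(i : ℤ)) ω) =ᵐ[μ]
      μ[fun ω => g (X 1 ω) | sigmaOf X (Set.Iic 0)]) :
    (fun x => G (pastOf x)) =ᵐ[μ.map (path X)] pastMean (μ.map (path X)) g :=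
  (ae_map_iff hX.measurable_path.aemeasurable
    (measurableSet_eq_fun (hGm.comp measurable_pastOf) (measurable_pastMean g))).2
    (hG.trans (hX.condExp_eq_comp_path g (Set.Iic 0) 1))

lemma measure_lt_error_le [Fintype α] (hX : IsStationaryErgodic μ X) (g : α → ℝ) (ε : ℝ) (n : ℕ) :
    μ {ω | ε < error μ X g n ω} ≤
      μ.map (path X) {x | ε < predictionError (μ.map (path X)) g n x} := by
  refine le_trans (measure_mono_ae ?_) (Measure.le_map_apply hX.measurable_path.aemeasurable _)
  filter_upwards [hX.ae_error_eq g] with ω hω (hlt : ε < error μ X g n ω)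
  exact (hω n ▸ hlt : ε < predictionError (μ.map (path X)) g n (path X ω))

end IsStationaryErgodic

end Transfer

end Forecast

end

open Forecast in
theorem mainTheorem1 {Ω α : Type*} [MeasurableSpace Ω] (μ : Measure Ω) [IsProbabilityMeasure μ]
    [Fintype α] [MeasurableSpace α] [MeasurableSingletonClass α]
    (X : ℤ → Ω → α) (hX : Forecast.IsStationaryErgodic μ X) (g : α → ℝ) :
    (Forecast.HasContinuousVersion μ X g →
      ∀ᵐ ω ∂μ, Tendsto (fun n : ℕ => Forecast.error μ X g n ω) atTop (𝓝 0)) ∧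
    (∀ᵐ ω ∂μ, Tendsto
      (fun n : ℕ => (1 / (n : ℝ)) * ∑ i ∈ Finset.range n, Forecast.error μ X g i ω)
      atTop (𝓝 0)) ∧
    (∀ ε : ℝ, 0 < ε →
      Tendsto (fun n : ℕ => μ {ω | ε < Forecast.error μ X g n ω}) atTop (𝓝 0)) := by
  have hpath : AEMeasurable (path X) μ := hX.measurable_path.aemeasurable
  have := Measure.isProbabilityMeasure_map hpath
  have : Nonempty α := μ.nonempty_of_neZero.map (X 0)
  refine ⟨fun ⟨G, hG, hGc⟩ => ?_, ?_, fun ε hε => ?_⟩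
  · have hGc : DStarContinuous G := hGc
    filter_upwards [hX.ae_error_eq g, ae_of_ae_map hpath (ae_tendsto_predictionError hX.2
      (hX.ae_pastOf_eq_pastMean hGc.measurable hG) hGc)] with ω herror hlim
    simpa only [herror] using hlim
  · filter_upwards [hX.ae_error_eq g, ae_of_ae_map hpath (ae_avgLE_predictionError hX.2 g)]
      with ω herror havg
    simpa only [herror] using havg.tendsto fun n => predictionError_nonneg g n _
  · have hlim := ENNReal.tendsto_ofReal
      (tendsto_measureReal_predictionError hX.2.toMeasurePreserving g hε)
    rw [ENNReal.ofReal_zero] at hlim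
    refine tendsto_of_tendsto_of_tendsto_of_le_of_le tendsto_const_nhds hlim (fun _ => zero_le)
      fun n => (hX.measure_lt_error_le g ε n).trans_eq ?_
    exact (ofReal_measureReal (measure_ne_top _ _)).symm
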